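/- Let $q$ be a prime power, let $n\ge 1$ be an odd integer, and let $0\le k\le n$. Regard $V=\mathbb F_{q^{2n}}$ as an $n$-dimensional vector space over $\mathbb F_{q^2}$ with the Hermitian form $$(\alpha,\beta):=\mathrm{Tr}_{\mathbb F_{q^{2n}}/\mathbb F_{q^2}}\bigl(\alpha\,\beta^{q^n}\bigr).$$ Call an $\mathbb F_{q^2}$-subspace $W\subseteq V$ nondegenerate if the only $\alpha\in W$ with $(\alpha,\beta)=0$ for all $\beta\in W$ is $\alpha=0$, and let $X$ be the set of all nondegenerate $k$-dimensional $\mathbb F_{q^2}$-subspaces of $V$. Let $\gamma$ be a generator of the cyclic group $\mathbb F_{q^{2n}}^\times$ and let $C:=\langle\gamma^{q^n-1}\rangle$, acting on subspaces of $V$ by $W\mapsto cW$. Put $$X(t):=t^E\cdot\prod_{i=0}^{k-1}\frac{1-t^{q^n+(-q)^{n-k+i}}}{1-t^{q^k-(-1)^k(-q)^i}}\cdot\prod_{i=0}^{k-1}\frac{1-t^{q^n+(-q)^i}}{1-t^{q^k-(-1)^k(-q)^i}},$$ where $E:=0$ if $k$ is odd and $E:=2\sum_{i=0}^{k-1}\bigl(q^k-(-q)^i\bigr)$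 if $k$ is even. Then $C\cong\mathbb Z/(q^n+1)\mathbb Z$, the group $C$ permutes $X$, the rational function $X(t)$ is a polynomial in $t$ with nonnegative integer coefficients, and the triple $(X,X(t),C)$ exhibits the cyclic sieving phenomenon: for every $c\in C$ and every complex root of unity $\omega$ whose multiplicative order equals that of $c$, $$\#\{W\in X: cW=W\}=X(\omega).$$ -/

import Mathlib

open scoped Pointwise

noncomputable section

/-- The cyclic sieving phenomenon for `(X, P, C)`: `C` is a finite cyclic group, `X` is a finite
set (inside a type on which `C` acts) that `C` permutes, `P` is a polynomial with nonnegative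
integer coefficients, and for every `c ∈ C` and every complex root of unity `ω` of the same
multiplicative order as `c`, the number of `x ∈ X` with `c • x = x` is `P(ω)`. -/
structure CyclicSieving {S : Type*} (C : Type*) [Group C] [MulAction C S]
    (X : Set S) (P : Polynomial ℕ) : Prop where
  finite_group : Finite C
  isCyclic : IsCyclic C
  finite_set : X.Finite
  smul_mem : ∀ (c : C), ∀ x ∈ X, c • x ∈ X
  card_fixed : ∀ (c : C) (ω : ℂ), orderOf ω = orderOf c →
    (Set.ncard {x : S | x ∈ X ∧ c • x = x} : ℂ) = Polynomial.aeval ω P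

/-- The trace Hermitian form `(α, β) = Tr_{L/K}(α β^(q^n))`, where `K = 𝔽_{q²}` and
`L = 𝔽_{q^{2n}}`. -/
def traceForm (q n : ℕ) (K : Type*) {L : Type*} [Field K] [Field L] [Algebra K L]
    (α β : L) : K :=
  Algebra.trace K L (α * β ^ (q ^ n))

/-- A `K`-subspace `W` of `L` is nondegenerate if the restriction of the form to `W` is. -/
def IsNondegenerateSubspace (q n : ℕ) {K L : Type*} [Field K] [Field L] [Algebra K L]
    (W : Submodule K L) : Prop :=
  ∀ α ∈ W, (∀ β ∈ W, traceForm q n K α β = 0) → α = 0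

/-- The set of nondegenerate `k`-dimensional `K`-subspaces of `L`. -/
def nondegenerateSubspaces (q n k : ℕ) (K L : Type*) [Field K] [Field L] [Algebra K L] :
    Set (Submodule K L) :=
  {W | Module.finrank K W = k ∧ IsNondegenerateSubspace q n W}

/-- The exponent `E`. -/
def sievingExponent (q k : ℕ) : ℤ :=
  if Odd k then 0 else 2 * ∑ i ∈ Finset.range k, ((q : ℤ) ^ k - (-(q : ℤ)) ^ i)

/-- The rational function `X(t)`; the exponents of `t` are integers. -/
def sievingFunction (q n k : ℕ) : RatFunc ℚ :=
  let t : RatFunc ℚ := RatFunc.X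
  t ^ sievingExponent q k *
    (∏ i ∈ Finset.range k,
      (1 - t ^ ((q : ℤ) ^ n + (-(q : ℤ)) ^ (n - k + i))) /
        (1 - t ^ ((q : ℤ) ^ k - (-1) ^ k * (-(q : ℤ)) ^ i))) *
    (∏ i ∈ Finset.range k,
      (1 - t ^ ((q : ℤ) ^ n + (-(q : ℤ)) ^ i)) /
        (1 - t ^ ((q : ℤ) ^ k - (-1) ^ k * (-(q : ℤ)) ^ i)))

end

namespace NegativeQBinomial

open Finset Polynomial

section Recurrences

variable {F : Type*} [Field F]

/-- The `(q,t)`-binomial coefficient with base `Q`, evaluated at `t = u`. -/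
def qtBinomial (Q : ℤ) (n k : ℕ) (u : F) : F :=
  ∏ i ∈ range k, (1 - u ^ (Q ^ n - Q ^ i)) / (1 - u ^ (Q ^ k - Q ^ i))

/-- The quotient of the `(q,t)`-factorials of `k` at `u ^ Q` and at `u`. -/
def factorialRatio (Q : ℤ) (k : ℕ) (u : F) : F :=
  ∏ i ∈ range k, (1 - u ^ (Q * (Q ^ k - Q ^ i))) / (1 - u ^ (Q ^ k - Q ^ i))

@[simp] lemma qtBinomial_zero_right (Q : ℤ) (n : ℕ) (u : F) : qtBinomial Q n 0 u = 1 := by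
  simp [qtBinomial]

lemma qtBinomial_eq_zero_of_lt (Q : ℤ) {n k : ℕ} (h : n < k) (u : F) :
    qtBinomial Q n k u = 0 := by
  refine prod_eq_zero (mem_range.2 h) ?_
  simp

lemma pow_sub_pow_ne_zero {Q : ℤ} (hQ : 2 ≤ |Q|) {i k : ℕ} (h : i < k) : Q ^ k - Q ^ i ≠ 0 := by
  intro h0
  have h1 : |Q| ^ k = |Q| ^ i := by
    rw [← abs_pow, ← abs_pow, sub_eq_zero.1 h0]
  exact absurd (pow_lt_pow_right₀ (by linarith : 1 < |Q|) h) (by rw [h1]; exact lt_irrefl _)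

lemma one_sub_zpow_ne_zero {u : F} (hu : ∀ m : ℤ, m ≠ 0 → u ^ m ≠ 1) {m : ℤ} (hm : m ≠ 0) :
    1 - u ^ m ≠ 0 :=
  sub_ne_zero.2 (hu m hm).symm

lemma qtBinomial_succ_succ (Q : ℤ) (n k : ℕ) (u : F) :
    qtBinomial Q (n + 1) (k + 1) u =
      qtBinomial Q n k (u ^ Q) *
        ((1 - u ^ (Q ^ (n + 1) - 1)) / (1 - u ^ (Q ^ (k + 1) - 1))) := by
  unfold qtBinomial
  rw [prod_range_succ']
  simp only [pow_zero, ← zpow_mul, mul_sub, ← pow_succ']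

lemma factorialRatio_mul_qtBinomial {Q : ℤ} (hQ : 2 ≤ |Q|) (n k : ℕ) {u : F}
    (hu : ∀ m : ℤ, m ≠ 0 → u ^ m ≠ 1) :
    factorialRatio Q (k + 1) u * qtBinomial Q n (k + 1) (u ^ Q) =
      qtBinomial Q n k (u ^ Q) *
        ((1 - u ^ (Q ^ (n + 1) - Q ^ (k + 1))) / (1 - u ^ (Q ^ (k + 1) - 1))) := by
  have hQ0 : Q ≠ 0 := by rintro rfl; simp at hQ
  unfold factorialRatio qtBinomial
  rw [← prod_mul_distrib]
  have h : ∀ i ∈ range (k + 1),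
      (1 - u ^ (Q * (Q ^ (k + 1) - Q ^ i))) / (1 - u ^ (Q ^ (k + 1) - Q ^ i)) *
        ((1 - (u ^ Q) ^ (Q ^ n - Q ^ i)) / (1 - (u ^ Q) ^ (Q ^ (k + 1) - Q ^ i))) =
      (1 - u ^ (Q ^ (n + 1) - Q ^ (i + 1))) / (1 - u ^ (Q ^ (k + 1) - Q ^ i)) := by
    intro i hi
    have h0 := pow_sub_pow_ne_zero hQ (mem_range.1 hi)
    have h1 := one_sub_zpow_ne_zero hu (mul_ne_zero hQ0 h0)
    have h2 : Q ^ (n + 1) - Q ^ (i + 1) = Q * (Q ^ n - Q ^ i) := by ring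
    rw [← zpow_mul, ← zpow_mul, h2]
    field_simp
  rw [prod_congr rfl h, prod_div_distrib, prod_range_succ, prod_range_succ', prod_div_distrib]
  have h1 : ∀ m i : ℕ, Q * (Q ^ m - Q ^ i) = Q ^ (m + 1) - Q ^ (i + 1) := fun m i => by ring
  simp only [pow_zero, ← zpow_mul, h1]
  rw [mul_div_mul_comm]

lemma qtBinomial_pascal {Q : ℤ} (hQ : 2 ≤ |Q|) (n k : ℕ) {u : F} (hu0 : u ≠ 0)
    (hu : ∀ m : ℤ, m ≠ 0 → u ^ m ≠ 1) :
    qtBinomial Q (n + 1) (k + 1) u = qtBinomial Q n k (u ^ Q) +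
      u ^ (Q ^ (k + 1) - 1) * (factorialRatio Q (k + 1) u * qtBinomial Q n (k + 1) (u ^ Q)) := by
  have h0 : Q ^ (k + 1) - 1 ≠ 0 := by simpa using pow_sub_pow_ne_zero hQ (Nat.succ_pos k)
  have h1 := one_sub_zpow_ne_zero hu h0
  have h2 : u ^ (Q ^ (n + 1) - 1) = u ^ (Q ^ (n + 1) - Q ^ (k + 1)) * u ^ (Q ^ (k + 1) - 1) := by
    rw [← zpow_add₀ hu0]; congr 1; ring
  rw [factorialRatio_mul_qtBinomial hQ n k hu, qtBinomial_succ_succ, h2]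
  field_simp
  ring

lemma qtBinomial_pascal_dual {Q : ℤ} (hQ : 2 ≤ |Q|) (n k : ℕ) {u : F} (hu0 : u ≠ 0)
    (hu : ∀ m : ℤ, m ≠ 0 → u ^ m ≠ 1) :
    qtBinomial Q (n + 1) (k + 1) u =
      factorialRatio Q (k + 1) u * qtBinomial Q n (k + 1) (u ^ Q) +
        u ^ (Q ^ (n + 1) - Q ^ (k + 1)) * qtBinomial Q n k (u ^ Q) := by
  have h0 : Q ^ (k + 1) - 1 ≠ 0 := by simpa using pow_sub_pow_ne_zero hQ (Nat.succ_pos k)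
  have h1 := one_sub_zpow_ne_zero hu h0
  have h2 : u ^ (Q ^ (n + 1) - 1) = u ^ (Q ^ (n + 1) - Q ^ (k + 1)) * u ^ (Q ^ (k + 1) - 1) := by
    rw [← zpow_add₀ hu0]; congr 1; ring
  rw [factorialRatio_mul_qtBinomial hQ n k hu, qtBinomial_succ_succ, h2]
  field_simp
  ring

lemma factorialRatio_succ (Q : ℤ) (k : ℕ) (u : F) :
    factorialRatio Q (k + 1) u = factorialRatio Q k (u ^ Q) *
      ((1 - (u ^ (Q ^ (k + 1) - 1)) ^ Q) / (1 - u ^ (Q ^ (k + 1) - 1))) := by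
  unfold factorialRatio
  rw [prod_range_succ']
  simp only [pow_zero, ← zpow_mul, mul_sub, ← pow_succ', mul_comm, mul_one]

lemma one_sub_zpow_neg_div {s : F} (hs0 : s ≠ 0) (hs : s ≠ 1) (q : ℕ) :
    (1 - s ^ (-(q : ℤ))) / (1 - s) = -(s ^ (-(q : ℤ)) * ∑ j ∈ range q, s ^ j) := by
  rw [geom_sum_eq hs, zpow_neg, zpow_natCast]
  have h1 : 1 - s ≠ 0 := sub_ne_zero.2 hs.symm
  have h2 : s - 1 ≠ 0 := sub_ne_zero.2 hs
  field_simp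
  ring

end Recurrences

section Positivity

/-- Laurent polynomials in `X` with nonnegative integer coefficients, as rational functions. -/
def IsNonnegLaurent (f : RatFunc ℚ) : Prop :=
  ∃ (e : ℤ) (P : ℕ[X]), f = RatFunc.X ^ e * aeval RatFunc.X P

namespace IsNonnegLaurent

lemma zero : IsNonnegLaurent 0 := ⟨0, 0, by simp⟩

lemma zpow (e : ℤ) : IsNonnegLaurent (RatFunc.X ^ e) := ⟨e, 1, by simp⟩

lemma one : IsNonnegLaurent 1 := ⟨0, 1, by simp⟩

lemma mul {f g : RatFunc ℚ} (hf : IsNonnegLaurent f) (hg : IsNonnegLaurent g) :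
    IsNonnegLaurent (f * g) := by
  obtain ⟨e, P, rfl⟩ := hf
  obtain ⟨e', P', rfl⟩ := hg
  exact ⟨e + e', P * P', by rw [zpow_add₀ RatFunc.X_ne_zero, map_mul]; ring⟩

lemma add {f g : RatFunc ℚ} (hf : IsNonnegLaurent f) (hg : IsNonnegLaurent g) :
    IsNonnegLaurent (f + g) := by
  obtain ⟨e, P, rfl⟩ := hf
  obtain ⟨e', P', rfl⟩ := hg
  obtain ⟨a, ha⟩ := Int.eq_ofNat_of_zero_le (sub_nonneg.2 (min_le_left e e'))
  obtain ⟨b, hb⟩ := Int.eq_ofNat_of_zero_le (sub_nonneg.2 (min_le_right e e'))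
  refine ⟨min e e', X ^ a * P + X ^ b * P', ?_⟩
  have h1 : (RatFunc.X : RatFunc ℚ) ^ e = RatFunc.X ^ min e e' * RatFunc.X ^ a := by
    rw [← zpow_natCast, ← zpow_add₀ RatFunc.X_ne_zero, ← ha]; congr 1; ring
  have h2 : (RatFunc.X : RatFunc ℚ) ^ e' = RatFunc.X ^ min e e' * RatFunc.X ^ b := by
    rw [← zpow_natCast, ← zpow_add₀ RatFunc.X_ne_zero, ← hb]; congr 1; ring
  rw [h1, h2]
  simp only [map_add, map_mul, map_pow, aeval_X]
  ring

lemma sum {ι : Type*} (s : Finset ι) {f : ι → RatFunc ℚ} (h : ∀ i ∈ s, IsNonnegLaurent (f i)) :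
    IsNonnegLaurent (∑ i ∈ s, f i) :=
  sum_induction f IsNonnegLaurent (fun _ _ => add) zero h

lemma prod {ι : Type*} (s : Finset ι) {f : ι → RatFunc ℚ} (h : ∀ i ∈ s, IsNonnegLaurent (f i)) :
    IsNonnegLaurent (∏ i ∈ s, f i) :=
  prod_induction f IsNonnegLaurent (fun _ _ => mul) one h

lemma geom_sum (j : ℤ) (q : ℕ) :
    IsNonnegLaurent (∑ i ∈ range q, ((RatFunc.X : RatFunc ℚ) ^ j) ^ i) :=
  sum _ fun i _ => by rw [← zpow_natCast, ← zpow_mul]; exact zpow _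

end IsNonnegLaurent

lemma X_zpow_ne_one {m : ℤ} (hm : m ≠ 0) : (RatFunc.X : RatFunc ℚ) ^ m ≠ 1 := by
  intro h
  have hnat : ∀ a : ℕ, a ≠ 0 → (RatFunc.X : RatFunc ℚ) ^ a ≠ 1 := by
    intro a ha h1
    rw [← RatFunc.algebraMap_X, ← map_pow, ← map_one (algebraMap ℚ[X] (RatFunc ℚ))] at h1
    have h2 := congrArg natDegree (RatFunc.algebraMap_injective ℚ h1)
    simp [ha] at h2
  rcases Int.eq_nat_or_neg m with ⟨a, rfl | rfl⟩
  · exact hnat a (by simpa using hm) (by simpa using h)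
  · exact hnat a (by simpa using hm) (by simpa using h)

lemma X_zpow_zpow_ne_one {j : ℤ} (hj : j ≠ 0) (m : ℤ) (hm : m ≠ 0) :
    ((RatFunc.X : RatFunc ℚ) ^ j) ^ m ≠ 1 := by
  rw [← zpow_mul]; exact X_zpow_ne_one (mul_ne_zero hj hm)

lemma X_zpow_ne_zero (j : ℤ) : (RatFunc.X : RatFunc ℚ) ^ j ≠ 0 := zpow_ne_zero _ RatFunc.X_ne_zero

lemma isNonnegLaurent_factorialRatio {q : ℕ} (hq : 2 ≤ q) (k : ℕ) {j : ℤ} (hj : j ≠ 0) :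
    IsNonnegLaurent ((-1) ^ k * factorialRatio (-(q : ℤ)) k (RatFunc.X ^ j)) := by
  unfold factorialRatio
  rw [← card_range k, ← prod_const, card_range, ← prod_mul_distrib]
  refine IsNonnegLaurent.prod _ fun i hi => ?_
  have hQ : (2 : ℤ) ≤ |(-(q : ℤ))| := by simp; exact_mod_cast hq
  have h0 := pow_sub_pow_ne_zero hQ (mem_range.1 hi)
  rw [mul_comm (-(q : ℤ)), zpow_mul, one_sub_zpow_neg_div (zpow_ne_zero _ (X_zpow_ne_zero j))
    (X_zpow_zpow_ne_one hj _ h0), neg_one_mul, neg_neg]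
  simp only [← zpow_mul (RatFunc.X : RatFunc ℚ)]
  exact (IsNonnegLaurent.zpow _).mul (IsNonnegLaurent.geom_sum _ _)

/-- Two Pascal steps combined so that, when `n - k` is odd, all terms have the same sign. -/
lemma qtBinomial_two_step {q : ℕ} (hq : 2 ≤ q) (n k : ℕ) {F : Type*} [Field F] {u : F}
    (hu0 : u ≠ 0) (hu : ∀ m : ℤ, m ≠ 0 → u ^ m ≠ 1) :
    qtBinomial (-(q : ℤ)) (n + 2) (k + 1) u =
      (qtBinomial (-(q : ℤ)) (n + 1) k (u ^ (-(q : ℤ))) -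
        factorialRatio (-(q : ℤ)) k (u ^ (-(q : ℤ))) *
          qtBinomial (-(q : ℤ)) n k ((u ^ (-(q : ℤ))) ^ (-(q : ℤ)))) -
      factorialRatio (-(q : ℤ)) k (u ^ (-(q : ℤ))) *
        ((u ^ ((-(q : ℤ)) ^ (k + 1) - 1)) ^ (-(q : ℤ) + 1) *
          ∑ j ∈ range (q - 1), (u ^ ((-(q : ℤ)) ^ (k + 1) - 1)) ^ j) *
          qtBinomial (-(q : ℤ)) n k ((u ^ (-(q : ℤ))) ^ (-(q : ℤ))) +
      u ^ ((-(q : ℤ)) ^ (k + 1) - 1) * (u ^ (-(q : ℤ))) ^ ((-(q : ℤ)) ^ (k + 1) - 1) *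
        factorialRatio (-(q : ℤ)) (k + 1) u *
        factorialRatio (-(q : ℤ)) (k + 1) (u ^ (-(q : ℤ))) *
          qtBinomial (-(q : ℤ)) n (k + 1) ((u ^ (-(q : ℤ))) ^ (-(q : ℤ))) := by
  have hQ : (2 : ℤ) ≤ |(-(q : ℤ))| := by simp; exact_mod_cast hq
  have hQ0 : -(q : ℤ) ≠ 0 := by intro h; rw [h] at hQ; simp at hQ
  have h0 : (-(q : ℤ)) ^ (k + 1) - 1 ≠ 0 := by
    simpa using pow_sub_pow_ne_zero hQ (Nat.succ_pos k)
  rw [qtBinomial_pascal hQ (n + 1) k hu0 hu,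
    qtBinomial_pascal hQ n k (zpow_ne_zero _ hu0)
      (fun m hm => by rw [← zpow_mul]; exact hu _ (mul_ne_zero hQ0 hm))]
  have hs : u ^ ((-(q : ℤ)) ^ (k + 1) - 1) * factorialRatio (-(q : ℤ)) (k + 1) u =
      -factorialRatio (-(q : ℤ)) k (u ^ (-(q : ℤ))) -
      factorialRatio (-(q : ℤ)) k (u ^ (-(q : ℤ))) *
        ((u ^ ((-(q : ℤ)) ^ (k + 1) - 1)) ^ (-(q : ℤ) + 1) *
          ∑ j ∈ range (q - 1), (u ^ ((-(q : ℤ)) ^ (k + 1) - 1)) ^ j) := by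
    rw [factorialRatio_succ]
    have hs0 := zpow_ne_zero ((-(q : ℤ)) ^ (k + 1) - 1) hu0
    have hs1 := hu _ h0
    generalize u ^ ((-(q : ℤ)) ^ (k + 1) - 1) = s at hs0 hs1 ⊢
    rw [one_sub_zpow_neg_div hs0 hs1]
    generalize factorialRatio (-(q : ℤ)) k (u ^ (-(q : ℤ))) = f
    obtain ⟨r, rfl⟩ : ∃ r, q = r + 1 := ⟨q - 1, by omega⟩
    rw [sum_range_succ, zpow_add₀ hs0, zpow_one, zpow_neg, zpow_natCast, Nat.add_sub_cancel]
    generalize ∑ j ∈ range r, s ^ j = S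
    field_simp
    ring
  linear_combination (qtBinomial (-(q : ℤ)) n k ((u ^ (-(q : ℤ))) ^ (-(q : ℤ))) +
    (u ^ (-(q : ℤ))) ^ ((-(q : ℤ)) ^ (k + 1) - 1) *
        (factorialRatio (-(q : ℤ)) (k + 1) (u ^ (-(q : ℤ))) *
          qtBinomial (-(q : ℤ)) n (k + 1) ((u ^ (-(q : ℤ))) ^ (-(q : ℤ))))) * hs -
          (u ^ (-(q : ℤ))) ^ ((-(q : ℤ)) ^ (k + 1) - 1) *
        (factorialRatio (-(q : ℤ)) (k + 1) (u ^ (-(q : ℤ))) *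
          qtBinomial (-(q : ℤ)) n (k + 1) ((u ^ (-(q : ℤ))) ^ (-(q : ℤ)))) * hs

theorem isNonnegLaurent_qtBinomial {q : ℕ} (hq : 2 ≤ q) (n : ℕ) : ∀ (k : ℕ) {j : ℤ}, j ≠ 0 →
    IsNonnegLaurent ((-1) ^ (k * (n + 1)) * qtBinomial (-(q : ℤ)) n k (RatFunc.X ^ j)) := by
  have hQ : (2 : ℤ) ≤ |(-(q : ℤ))| := by simp; exact_mod_cast hq
  have hQ0 : -(q : ℤ) ≠ 0 := by intro h; rw [h] at hQ; simp at hQ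
  induction n using Nat.strong_induction_on with
  | _ n ih =>
  intro k j hj
  rcases k with _ | k
  · simpa using IsNonnegLaurent.one
  rcases n with _ | n
  · simpa [qtBinomial_eq_zero_of_lt] using IsNonnegLaurent.zero
  have hjQ : j * -(q : ℤ) ≠ 0 := mul_ne_zero hj hQ0
  rcases Nat.even_or_odd (n + k) with hnk | hnk
  · rw [qtBinomial_pascal hQ n k (X_zpow_ne_zero j) (X_zpow_zpow_ne_one hj)]
    have h1 := ih n (Nat.lt_succ_self n) k hjQ
    have h2 := ih n (Nat.lt_succ_self n) (k + 1) hjQ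
    have h3 := isNonnegLaurent_factorialRatio hq (k + 1) hj
    have s0 : ((-1) ^ ((k + 1) * (n + 1 + 1)) : RatFunc ℚ) = 1 := Even.neg_one_pow (by grind)
    have s1 : ((-1) ^ (k * (n + 1)) : RatFunc ℚ) = 1 := Even.neg_one_pow (by grind)
    have s2 : ((-1) ^ ((k + 1) * (n + 1)) : RatFunc ℚ) = (-1) ^ (k + 1) := by
      rcases Nat.even_or_odd k with hk | hk
      · rw [Odd.neg_one_pow (by grind), Odd.neg_one_pow (by grind)]
      · rw [Even.neg_one_pow (by grind), Even.neg_one_pow (by grind)]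
    have s3 : ((-1) ^ (k + 1) : RatFunc ℚ) * (-1) ^ (k + 1) = 1 := by
      rw [← mul_pow]; simp
    rw [s1, one_mul, zpow_mul] at h1
    rw [s2, zpow_mul] at h2
    have h4 := h1.add ((IsNonnegLaurent.zpow (j * ((-(q : ℤ)) ^ (k + 1) - 1))).mul (h3.mul h2))
    rw [s0, one_mul]
    convert h4 using 2
    rw [zpow_mul, mul_mul_mul_comm, s3, one_mul]
  · rcases n with _ | n
    · have : 1 < k + 1 := by
        rcases k with _ | k
        · simp at hnk
        · omega
      simpa [qtBinomial_eq_zero_of_lt _ this] using IsNonnegLaurent.zero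
    have hjQQ := mul_ne_zero hjQ hQ0
    rw [qtBinomial_two_step hq n k (X_zpow_ne_zero j) (X_zpow_zpow_ne_one hj)]
    have h2 := ih n (by omega) k hjQQ
    have h3 := ih n (by omega) (k + 1) hjQQ
    have f1 := isNonnegLaurent_factorialRatio hq k hjQ
    have f2 := isNonnegLaurent_factorialRatio hq (k + 1) hj
    have f3 := isNonnegLaurent_factorialRatio hq (k + 1) hjQ
    have s0 : ((-1) ^ ((k + 1) * (n + 1 + 1 + 1)) : RatFunc ℚ) = -(-1) ^ k := by
      rcases Nat.even_or_odd k with hk | hk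
      · rw [Odd.neg_one_pow (by grind), Even.neg_one_pow (by grind)]
      · rw [Even.neg_one_pow (by grind), Odd.neg_one_pow (by grind), neg_neg]
    have s2 : ((-1) ^ (k * (n + 1)) : RatFunc ℚ) = 1 := Even.neg_one_pow (by grind)
    have s3 : ((-1) ^ ((k + 1) * (n + 1)) : RatFunc ℚ) = -(-1) ^ k := by
      rcases Nat.even_or_odd k with hk | hk
      · rw [Odd.neg_one_pow (by grind), Even.neg_one_pow (by grind)]
      · rw [Even.neg_one_pow (by grind), Odd.neg_one_pow (by grind), neg_neg]
    have h1 : IsNonnegLaurent (-(-1) ^ k *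
        (qtBinomial (-(q : ℤ)) (n + 1) k (RatFunc.X ^ (j * -(q : ℤ))) -
        factorialRatio (-(q : ℤ)) k (RatFunc.X ^ (j * -(q : ℤ))) *
          qtBinomial (-(q : ℤ)) n k (RatFunc.X ^ (j * -(q : ℤ) * -(q : ℤ))))) := by
      rcases k with _ | k
      · simpa [factorialRatio] using IsNonnegLaurent.zero
      · rw [qtBinomial_pascal_dual hQ n k (X_zpow_ne_zero _) (X_zpow_zpow_ne_one hjQ)]
        have h4 := ih n (by omega) k hjQQ
        have s4 : ((-1) ^ (k * (n + 1)) : RatFunc ℚ) = -(-1) ^ (k + 1) := by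
          rcases Nat.even_or_odd k with hk | hk
          · rw [Even.neg_one_pow (by grind), Odd.neg_one_pow (by grind), neg_neg]
          · rw [Odd.neg_one_pow (by grind), Even.neg_one_pow (by grind)]
        rw [s4] at h4
        convert (IsNonnegLaurent.zpow
          (j * -(q : ℤ) * ((-(q : ℤ)) ^ (n + 1) - (-(q : ℤ)) ^ (k + 1)))).mul h4 using 1
        rw [zpow_mul _ (j * -(q : ℤ)) (-(q : ℤ)),
          zpow_mul _ (j * -(q : ℤ)) ((-(q : ℤ)) ^ (n + 1) - (-(q : ℤ)) ^ (k + 1))]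
        ring
    rw [s2, one_mul] at h2
    rw [s3] at h3
    have h5 := f1.mul (((IsNonnegLaurent.zpow
      (j * ((-(q : ℤ)) ^ (k + 1) - 1) * (-(q : ℤ) + 1))).mul
      (IsNonnegLaurent.geom_sum (j * ((-(q : ℤ)) ^ (k + 1) - 1)) (q - 1))).mul h2)
    have h6 := (((IsNonnegLaurent.zpow (j * ((-(q : ℤ)) ^ (k + 1) - 1))).mul
      (IsNonnegLaurent.zpow (j * -(q : ℤ) * ((-(q : ℤ)) ^ (k + 1) - 1)))).mul (f2.mul f3)).mul h3
    have h7 := (h1.add h5).add h6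
    have s5 : ((-1) ^ (k + 1) : RatFunc ℚ) * (-1) ^ (k + 1) = 1 := by
      rw [← mul_pow]; simp
    rw [s0]
    simp only [zpow_mul] at h7
    convert h7 using 1
    linear_combination (-(RatFunc.X ^ j) ^ ((-(q : ℤ)) ^ (k + 1) - 1) *
      ((RatFunc.X ^ j) ^ (-(q : ℤ))) ^ ((-(q : ℤ)) ^ (k + 1) - 1) *
      factorialRatio (-(q : ℤ)) (k + 1) (RatFunc.X ^ j) *
      factorialRatio (-(q : ℤ)) (k + 1) ((RatFunc.X ^ j) ^ (-(q : ℤ))) * (-(-1) ^ k) *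
      qtBinomial (-(q : ℤ)) n (k + 1) (((RatFunc.X ^ j) ^ (-(q : ℤ))) ^ (-(q : ℤ)))) * s5

end Positivity

section Quotients

lemma aeval_X_eq_algebraMap (P : ℕ[X]) :
    aeval (RatFunc.X : RatFunc ℚ) P = algebraMap ℚ[X] (RatFunc ℚ) (P.map (Nat.castRingHom ℚ)) := by
  induction P using Polynomial.induction_on' with
  | add p q hp hq => simp [hp, hq]
  | monomial n a => simp [← C_mul_X_pow_eq_monomial]

lemma IsNonnegLaurent.exists_polynomial {f : RatFunc ℚ} (hf : IsNonnegLaurent f) {D N : ℚ[X]}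
    (hD : D.coeff 0 ≠ 0)
    (h : f * algebraMap ℚ[X] (RatFunc ℚ) D = algebraMap ℚ[X] (RatFunc ℚ) N) :
    ∃ P : ℕ[X], f = aeval RatFunc.X P := by
  have key : ∀ (e : ℕ) (P : ℕ[X]), f * RatFunc.X ^ e = aeval RatFunc.X P →
      ∃ P : ℕ[X], f = aeval RatFunc.X P := by
    intro e
    induction e with
    | zero => intro P hP; exact ⟨P, by simpa using hP⟩
    | succ e ih =>
      intro P hP
      have h1 : P.map (Nat.castRingHom ℚ) * D = N * X ^ (e + 1) := by
        apply RatFunc.algebraMap_injective ℚ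
        rw [map_mul, map_mul, ← aeval_X_eq_algebraMap, ← hP, ← h, map_pow, RatFunc.algebraMap_X]
        ring
      have h2 : P.coeff 0 = 0 := by
        have h3 := congrArg (fun R : ℚ[X] => R.coeff 0) h1
        simp only [mul_coeff_zero, coeff_map, coeff_X_pow] at h3
        simpa [hD] using h3
      obtain ⟨R, rfl⟩ := X_dvd_iff.2 h2
      refine ih R ?_
      apply mul_left_cancel₀ (RatFunc.X_ne_zero (K := ℚ))
      rw [map_mul, aeval_X] at hP
      rw [← hP]
      ring
  obtain ⟨e, P, rfl⟩ := hf
  rcases Int.eq_nat_or_neg e with ⟨a, rfl | rfl⟩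
  · exact ⟨X ^ a * P, by simp⟩
  · refine key a P ?_
    rw [zpow_neg, zpow_natCast]
    have := pow_ne_zero a (RatFunc.X_ne_zero (K := ℚ))
    field_simp

lemma algebraMap_one_sub_X_pow {a : ℤ} (ha : 0 ≤ a) :
    algebraMap ℚ[X] (RatFunc ℚ) (1 - X ^ a.toNat) = 1 - RatFunc.X ^ a := by
  obtain ⟨a, rfl⟩ := Int.eq_ofNat_of_zero_le ha
  simp

variable {k : ℕ} {a b : ℕ → ℤ}

lemma prod_one_sub_X_pow_coeff_zero (ha : ∀ i < k, 0 < a i) :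
    (∏ i ∈ range k, (1 - X ^ (a i).toNat : ℚ[X])).coeff 0 ≠ 0 := by
  rw [coeff_zero_prod]
  refine prod_ne_zero_iff.2 fun i hi => ?_
  have : (a i).toNat ≠ 0 := by have := ha i (mem_range.1 hi); omega
  simp [coeff_X_pow, this.symm]

lemma prod_div_mul_prod (ha : ∀ i < k, 0 < a i) (hb : ∀ i < k, 0 < b i) :
    (∏ i ∈ range k, (1 - (RatFunc.X : RatFunc ℚ) ^ a i) / (1 - RatFunc.X ^ b i)) *
      algebraMap ℚ[X] (RatFunc ℚ) (∏ i ∈ range k, (1 - X ^ (b i).toNat)) =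
      algebraMap ℚ[X] (RatFunc ℚ) (∏ i ∈ range k, (1 - X ^ (a i).toNat)) := by
  rw [map_prod, map_prod, ← prod_mul_distrib]
  refine prod_congr rfl fun i hi => ?_
  have hi := mem_range.1 hi
  rw [algebraMap_one_sub_X_pow (ha i hi).le, algebraMap_one_sub_X_pow (hb i hi).le,
    div_mul_cancel₀]
  exact one_sub_zpow_ne_zero (fun m => X_zpow_ne_one) (hb i hi).ne'

lemma map_mul_prod_eq {P : ℕ[X]} (ha : ∀ i < k, 0 < a i) (hb : ∀ i < k, 0 < b i)
    (h : ∏ i ∈ range k, (1 - (RatFunc.X : RatFunc ℚ) ^ a i) / (1 - RatFunc.X ^ b i) =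
      aeval RatFunc.X P) :
    P.map (Nat.castRingHom ℂ) * ∏ i ∈ range k, (1 - X ^ (b i).toNat) =
      ∏ i ∈ range k, (1 - X ^ (a i).toNat) := by
  have h1 := prod_div_mul_prod ha hb
  rw [h, aeval_X_eq_algebraMap, ← map_mul] at h1
  have h2 := congrArg (Polynomial.map (algebraMap ℚ ℂ)) (RatFunc.algebraMap_injective ℚ h1)
  have h3 : (algebraMap ℚ ℂ).comp (Nat.castRingHom ℚ) = Nat.castRingHom ℂ := Subsingleton.elim _ _
  simpa [Polynomial.map_prod, Polynomial.map_map, h3] using h2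

end Quotients

section RootOfUnity

/-- The leading coefficient of `1 - t ^ a` at `t = ω`, in terms of the local parameter
`1 - t ^ orderOf ω`. -/
noncomputable def leadingValue (ω : ℂ) (a : ℤ) : ℂ :=
  if (orderOf ω : ℤ) ∣ a then (a : ℂ) / orderOf ω else 1 - ω ^ a

lemma zpow_eq_one_iff_dvd {ω : ℂ} {a : ℤ} : ω ^ a = 1 ↔ (orderOf ω : ℤ) ∣ a := by
  by_cases h0 : ω = 0
  · subst h0
    simp only [orderOf_zero, Nat.cast_zero, zero_dvd_iff]
    exact ⟨fun h => by by_contra h1; simp [zero_zpow a h1] at h, fun h => by simp [h]⟩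
  · have h1 : (Units.mk0 ω h0 : ℂ) = ω := rfl
    rw [← h1, orderOf_units, orderOf_dvd_iff_zpow_eq_one, ← Units.val_zpow_eq_zpow_val,
      Units.val_eq_one]

lemma leadingValue_ne_zero {ω : ℂ} (hω : 0 < orderOf ω) {a : ℤ} (ha : 0 < a) :
    leadingValue ω a ≠ 0 := by
  unfold leadingValue
  split_ifs with h
  · have : (a : ℂ) ≠ 0 := by exact_mod_cast ha.ne'
    have : (orderOf ω : ℂ) ≠ 0 := by exact_mod_cast hω.ne'
    positivity
  · exact sub_ne_zero.2 fun h1 => h (zpow_eq_one_iff_dvd.1 h1.symm)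

lemma exists_factor {ω : ℂ} (hω : 0 < orderOf ω) {a : ℤ} (ha : 0 < a) :
    ∃ G : ℂ[X], 1 - X ^ a.toNat =
      (if (orderOf ω : ℤ) ∣ a then 1 - X ^ orderOf ω else 1) * G ∧
      G.eval ω = leadingValue ω a := by
  obtain ⟨a, rfl⟩ := Int.eq_ofNat_of_zero_le ha.le
  unfold leadingValue
  split_ifs with h
  · obtain ⟨c, rfl⟩ := Int.natCast_dvd_natCast.1 h
    refine ⟨∑ i ∈ range c, (X ^ orderOf ω) ^ i, ?_, ?_⟩
    · rw [mul_neg_geom_sum, ← pow_mul, Int.toNat_natCast]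
    · have : (orderOf ω : ℂ) ≠ 0 := by exact_mod_cast hω.ne'
      simp [eval_finsetSum, pow_orderOf_eq_one]
      field_simp
  · exact ⟨1 - X ^ a, by simp, by simp⟩

lemma exists_factor_prod {ω : ℂ} (hω : 0 < orderOf ω) {k : ℕ} {a : ℕ → ℤ}
    (ha : ∀ i < k, 0 < a i) :
    ∃ G : ℂ[X], ∏ i ∈ range k, (1 - X ^ (a i).toNat) =
      (1 - X ^ orderOf ω) ^ #{i ∈ range k | (orderOf ω : ℤ) ∣ a i} * G ∧
      G.eval ω = ∏ i ∈ range k, leadingValue ω (a i) := by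
  choose! G hG hG' using fun i (hi : i ∈ range k) => exists_factor hω (ha i (mem_range.1 hi))
  refine ⟨∏ i ∈ range k, G i, ?_, ?_⟩
  · rw [prod_congr rfl hG, prod_mul_distrib, prod_ite, prod_const_one, mul_one, prod_const]
  · rw [eval_prod, prod_congr rfl hG']

lemma aeval_eq_eval_map (P : ℕ[X]) (ω : ℂ) :
    aeval ω P = (P.map (Nat.castRingHom ℂ)).eval ω := by
  rw [eval_map, aeval_def]; congr

lemma one_sub_X_pow_ne_zero {d : ℕ} (hd : 0 < d) : (1 - X ^ d : ℂ[X]) ≠ 0 := by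
  intro h
  have := congrArg (eval 0) h
  simp [hd.ne'] at this

variable {ω : ℂ} {k : ℕ} {a b : ℕ → ℤ} {P : ℕ[X]}

lemma aeval_mul_prod_leadingValue (hω : 0 < orderOf ω)
    (ha : ∀ i < k, 0 < a i) (hb : ∀ i < k, 0 < b i)
    (h : ∏ i ∈ range k, (1 - (RatFunc.X : RatFunc ℚ) ^ a i) / (1 - RatFunc.X ^ b i) =
      aeval RatFunc.X P)
    (hcard : #{i ∈ range k | (orderOf ω : ℤ) ∣ a i} = #{i ∈ range k | (orderOf ω : ℤ) ∣ b i}) :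
    aeval ω P * ∏ i ∈ range k, leadingValue ω (b i) = ∏ i ∈ range k, leadingValue ω (a i) := by
  have h1 := map_mul_prod_eq ha hb h
  obtain ⟨G, hG, hG'⟩ := exists_factor_prod hω ha
  obtain ⟨H, hH, hH'⟩ := exists_factor_prod hω hb
  rw [hG, hH, hcard, mul_left_comm] at h1
  have h2 := mul_left_cancel₀ (pow_ne_zero _ (one_sub_X_pow_ne_zero hω)) h1
  rw [← hG', ← hH', ← h2, eval_mul, aeval_eq_eval_map]

lemma aeval_eq_zero_of_card_lt (hω : 0 < orderOf ω)
    (ha : ∀ i < k, 0 < a i) (hb : ∀ i < k, 0 < b i)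
    (h : ∏ i ∈ range k, (1 - (RatFunc.X : RatFunc ℚ) ^ a i) / (1 - RatFunc.X ^ b i) =
      aeval RatFunc.X P)
    (hcard : #{i ∈ range k | (orderOf ω : ℤ) ∣ b i} < #{i ∈ range k | (orderOf ω : ℤ) ∣ a i}) :
    aeval ω P = 0 := by
  have h1 := map_mul_prod_eq ha hb h
  obtain ⟨G, hG, hG'⟩ := exists_factor_prod hω ha
  obtain ⟨H, hH, hH'⟩ := exists_factor_prod hω hb
  obtain ⟨r, hr⟩ := Nat.exists_eq_add_of_lt hcard
  rw [hG, hH, hr, mul_left_comm, add_assoc, pow_add, mul_assoc] at h1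
  have h2 := mul_left_cancel₀ (pow_ne_zero _ (one_sub_X_pow_ne_zero hω)) h1
  have h3 := congrArg (eval ω) h2
  rw [eval_mul, hH', ← aeval_eq_eval_map] at h3
  simp only [eval_mul, eval_pow, eval_sub, eval_one, eval_X, pow_orderOf_eq_one, sub_self,
    pow_succ, mul_zero, zero_mul, mul_eq_zero] at h3
  refine h3.resolve_right (prod_ne_zero_iff.2 fun i hi => ?_)
  exact leadingValue_ne_zero hω (hb i (mem_range.1 hi))

end RootOfUnity

section Exponents

variable {q n k : ℕ}

lemma numExponent_eq (hn : Odd n) (i : ℕ) :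
    (q : ℤ) ^ n + (-(q : ℤ)) ^ i = -((-(q : ℤ)) ^ n - (-(q : ℤ)) ^ i) := by
  rw [hn.neg_pow (q : ℤ)]; ring

lemma denExponent_eq (i : ℕ) :
    (q : ℤ) ^ k - (-1) ^ k * (-(q : ℤ)) ^ i = (-1) ^ k * ((-(q : ℤ)) ^ k - (-(q : ℤ)) ^ i) := by
  rw [mul_sub, ← mul_pow]; simp

lemma abs_neg_pow_lt (hq : 2 ≤ q) {i : ℕ} (hi : i < k) : |(-(q : ℤ)) ^ i| < (q : ℤ) ^ k := by
  rw [abs_pow, abs_neg, Nat.abs_cast]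
  exact pow_lt_pow_right₀ (by exact_mod_cast hq) hi

lemma numExponent_pos (hq : 2 ≤ q) {i : ℕ} (hi : i < n) : 0 < (q : ℤ) ^ n + (-(q : ℤ)) ^ i := by
  have := abs_lt.1 (abs_neg_pow_lt hq hi)
  linarith

lemma denExponent_pos (hq : 2 ≤ q) {i : ℕ} (hi : i < k) :
    0 < (q : ℤ) ^ k - (-1) ^ k * (-(q : ℤ)) ^ i := by
  have h := abs_lt.1 (abs_neg_pow_lt hq hi)
  rcases neg_one_pow_eq_or ℤ k with h1 | h1 <;> rw [h1] <;> linarith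

lemma numExponent_eq_mul (hn : Odd n) (hk : k ≤ n) (i : ℕ) :
    (q : ℤ) ^ n + (-(q : ℤ)) ^ (n - k + i) =
      (q : ℤ) ^ (n - k) * ((q : ℤ) ^ k - (-1) ^ k * (-(q : ℤ)) ^ i) := by
  obtain ⟨r, rfl⟩ := Nat.exists_eq_add_of_le' hk
  have h1 : (-1 : ℤ) ^ r * (-1) ^ k = -1 := by rw [← pow_add, hn.neg_one_pow]
  have h2 : (-1 : ℤ) ^ k * (-1) ^ k = 1 := by rw [← mul_pow]; simp
  rw [Nat.add_sub_cancel, pow_add (-(q : ℤ)), neg_pow (q : ℤ) r, pow_add]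
  linear_combination ((q : ℤ) ^ r * (-(q : ℤ)) ^ i * (-1) ^ k) * h1 -
    (-1) ^ r * (q : ℤ) ^ r * (-(q : ℤ)) ^ i * h2

end Exponents

section SievingPolynomial

variable {q n k : ℕ}

lemma exists_polynomial_geometric (hq : 2 ≤ q) (hn : Odd n) (hk : k ≤ n) :
    ∃ P : ℕ[X], ∏ i ∈ range k, (1 - (RatFunc.X : RatFunc ℚ) ^
        ((q : ℤ) ^ n + (-(q : ℤ)) ^ (n - k + i))) /
        (1 - RatFunc.X ^ ((q : ℤ) ^ k - (-1) ^ k * (-(q : ℤ)) ^ i)) = aeval RatFunc.X P := by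
  refine ⟨∏ i ∈ range k, ∑ j ∈ range (q ^ (n - k)),
    (X ^ ((q : ℤ) ^ k - (-1) ^ k * (-(q : ℤ)) ^ i).toNat) ^ j, ?_⟩
  rw [map_prod]
  refine prod_congr rfl fun i hi => ?_
  have hpos := denExponent_pos hq (mem_range.1 hi)
  rw [numExponent_eq_mul hn hk]
  generalize (q : ℤ) ^ k - (-1) ^ k * (-(q : ℤ)) ^ i = b at hpos ⊢
  have h1 := X_zpow_ne_one hpos.ne'
  obtain ⟨b, rfl⟩ := Int.eq_ofNat_of_zero_le hpos.le
  rw [mul_comm, zpow_mul]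
  simp only [zpow_natCast, Int.toNat_natCast, map_sum, map_pow, aeval_X] at h1 ⊢
  rw [geom_sum_eq h1, ← neg_div_neg_eq, neg_sub, neg_sub]
  congr 2

lemma exists_polynomial_binomial (hq : 2 ≤ q) (hn : Odd n) (hk : k ≤ n) :
    ∃ P : ℕ[X], ∏ i ∈ range k, (1 - (RatFunc.X : RatFunc ℚ) ^ ((q : ℤ) ^ n + (-(q : ℤ)) ^ i)) /
        (1 - RatFunc.X ^ ((q : ℤ) ^ k - (-1) ^ k * (-(q : ℤ)) ^ i)) = aeval RatFunc.X P := by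
  have ha : ∀ i < k, 0 < (q : ℤ) ^ n + (-(q : ℤ)) ^ i :=
    fun i hi => numExponent_pos hq (hi.trans_le hk)
  have hb : ∀ i < k, 0 < (q : ℤ) ^ k - (-1) ^ k * (-(q : ℤ)) ^ i :=
    fun i hi => denExponent_pos hq hi
  refine IsNonnegLaurent.exists_polynomial ?_ (prod_one_sub_X_pow_coeff_zero hb)
    (prod_div_mul_prod ha hb)
  have hB := isNonnegLaurent_qtBinomial hq n k one_ne_zero
  rw [Even.neg_one_pow (by grind), one_mul, zpow_one] at hB
  have hflip : ∀ a : ℤ, 1 - (RatFunc.X : RatFunc ℚ) ^ a =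
      -(RatFunc.X ^ a) * (1 - RatFunc.X ^ (-a)) := by
    intro a
    have := X_zpow_ne_zero a
    rw [zpow_neg]
    field_simp
    ring
  rcases Nat.even_or_odd k with hk2 | hk2
  · convert hB.mul (IsNonnegLaurent.prod (range k) fun i _ =>
      IsNonnegLaurent.zpow ((q : ℤ) ^ n + (-(q : ℤ)) ^ i)) using 1
    have h1 : ∏ i ∈ range k, (-1 : RatFunc ℚ) = 1 := by simp [hk2.neg_one_pow]
    suffices h : _ = (∏ i ∈ range k, (-1 : RatFunc ℚ)) * (_ * _) by rwa [h1, one_mul] at h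
    rw [qtBinomial, ← prod_mul_distrib, ← prod_mul_distrib]
    refine prod_congr rfl fun i _ => ?_
    have e1 := numExponent_eq (q := q) hn i
    have e2 := denExponent_eq (q := q) (k := k) i
    rw [hk2.neg_one_pow, one_mul, one_mul] at e2
    rw [← neg_eq_iff_eq_neg] at e1
    rw [hk2.neg_one_pow, one_mul, ← e1, ← e2]
    generalize (q : ℤ) ^ n + (-(q : ℤ)) ^ i = a
    rw [hflip a]
    ring
  · convert hB.mul (IsNonnegLaurent.prod (range k) fun i _ =>
      IsNonnegLaurent.zpow ((q : ℤ) ^ n + (-(q : ℤ)) ^ i -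
        ((q : ℤ) ^ k - (-1) ^ k * (-(q : ℤ)) ^ i))) using 2
    rw [qtBinomial, ← prod_mul_distrib]
    refine prod_congr rfl fun i _ => ?_
    have e1 := numExponent_eq (q := q) hn i
    have e2 := denExponent_eq (q := q) (k := k) i
    rw [hk2.neg_one_pow, neg_one_mul, neg_one_mul, ← neg_eq_iff_eq_neg] at e2
    rw [← neg_eq_iff_eq_neg] at e1
    rw [hk2.neg_one_pow, neg_one_mul, ← e1, ← e2]
    generalize (q : ℤ) ^ n + (-(q : ℤ)) ^ i = a
    generalize (q : ℤ) ^ k - -(-(q : ℤ)) ^ i = b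
    rw [hflip a, hflip b, zpow_sub₀ RatFunc.X_ne_zero, neg_mul, neg_mul, neg_div_neg_eq,
      mul_div_mul_comm, mul_comm]

lemma sievingExponent_nonneg (hq : 2 ≤ q) : 0 ≤ sievingExponent q k := by
  unfold sievingExponent
  split_ifs
  · exact le_rfl
  · refine mul_nonneg (by norm_num) (sum_nonneg fun i hi => ?_)
    have := abs_lt.1 (abs_neg_pow_lt hq (mem_range.1 hi))
    linarith

end SievingPolynomial

section Multiples

variable {m k : ℕ}

lemma card_filter_dvd_sub (m k : ℕ) : #{i ∈ range k | m ∣ k - i} = k / m := by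
  rw [← Nat.card_multiples k m]
  refine card_nbij' (fun i => k - 1 - i) (fun i => k - 1 - i) ?_ ?_ ?_ ?_
  · intro i hi
    simp only [coe_filter, mem_range, Set.mem_ofPred_eq] at hi ⊢
    refine ⟨by omega, ?_⟩
    convert hi.2 using 1; omega
  · intro i hi
    simp only [coe_filter, mem_range, Set.mem_ofPred_eq] at hi ⊢
    refine ⟨by omega, ?_⟩
    convert hi.2 using 1; omega
  · intro i hi
    simp only [coe_filter, mem_range, Set.mem_ofPred_eq] at hi ⊢
    omega
  · intro i hi
    simp only [coe_filter, mem_range, Set.mem_ofPred_eq] at hi ⊢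
    omega

lemma card_filter_dvd_of_not_dvd (h : ¬ m ∣ k) : #{i ∈ range k | m ∣ i} = k / m + 1 := by
  rcases k with _ | k
  · simp at h
  have h1 : range (k + 1) = insert 0 ((range k).image (· + 1)) := by
    ext i; rcases i with _ | i <;> simp
  rw [h1, filter_insert, if_pos (dvd_zero m), card_insert_of_notMem (by simp), filter_image,
    card_image_of_injective _ (add_left_injective 1), Nat.card_multiples, Nat.succ_div_of_not_dvd h]

end Multiples

section Evaluation

variable {q n k m : ℕ} {ω : ℂ}

lemma dvd_pow_sub_pow_iff {d Q : ℤ} (hm : 0 < m) (hd : ∀ i : ℕ, d ∣ Q ^ i - 1 ↔ m ∣ i) {i k : ℕ}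
    (hik : i ≤ k) : d ∣ Q ^ k - Q ^ i ↔ m ∣ k - i := by
  obtain ⟨r, rfl⟩ := Nat.exists_eq_add_of_le hik
  have hcop : IsCoprime d Q := by
    obtain ⟨c, hc⟩ := (hd m).2 dvd_rfl
    refine ⟨-c, Q ^ (m - 1), ?_⟩
    have : Q ^ (m - 1) * Q = Q ^ m := by rw [← pow_succ]; congr 1; omega
    rw [this]; linear_combination hc
  rw [pow_add, ← mul_sub_one, Nat.add_sub_cancel_left, ← hd]
  exact ⟨fun h => IsCoprime.dvd_of_dvd_mul_left (IsCoprime.pow_right hcop) h,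
    fun h => h.mul_left _⟩

lemma zpow_eq_of_dvd_sub (hω : 0 < orderOf ω) {a b : ℤ} (h : (orderOf ω : ℤ) ∣ a - b) :
    ω ^ a = ω ^ b := by
  have h0 : ω ≠ 0 := by rintro rfl; simp at hω
  rw [← zpow_eq_one_iff_dvd, zpow_sub₀ h0] at h
  exact (div_eq_one_iff_eq (zpow_ne_zero _ h0)).1 h

lemma leadingValue_mul_leadingValue (hq : 2 ≤ q) (hn : Odd n) (hk : k ≤ n) (hω : 0 < orderOf ω)
    (hm : 0 < m) (hmn : m ∣ n) (hmk : m ∣ k)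
    (hd : ∀ i : ℕ, (orderOf ω : ℤ) ∣ (-(q : ℤ)) ^ i - 1 ↔ m ∣ i) {i : ℕ} (hi : i < k) :
    ω ^ (if Odd k then 0 else 2 * ((q : ℤ) ^ k - (-(q : ℤ)) ^ i)) *
        (leadingValue ω ((q : ℤ) ^ n + (-(q : ℤ)) ^ (n - k + i)) *
          leadingValue ω ((q : ℤ) ^ n + (-(q : ℤ)) ^ i)) =
      leadingValue ω ((q : ℤ) ^ k - (-1) ^ k * (-(q : ℤ)) ^ i) ^ 2 *
        (if m ∣ i then (q : ℂ) ^ (n - k) * (((q : ℂ) ^ n + (-(q : ℂ)) ^ i) /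
          ((q : ℂ) ^ k - (-1) ^ k * (-(q : ℂ)) ^ i)) else 1) := by
  have h0 : ω ≠ 0 := by rintro rfl; simp at hω
  have hd0 : (orderOf ω : ℂ) ≠ 0 := by exact_mod_cast hω.ne'
  have hbpos := denExponent_pos hq hi
  have hbC : ((q : ℂ) ^ k - (-1) ^ k * (-(q : ℂ)) ^ i) ≠ 0 := by exact_mod_cast hbpos.ne'
  have hQn := (hd n).2 hmn
  have hQk := (hd k).2 hmk
  have hQnk := (hd (n - k)).2 (Nat.dvd_sub hmn hmk)
  have hnum : (orderOf ω : ℤ) ∣ (q : ℤ) ^ n + (-(q : ℤ)) ^ i ↔ m ∣ i := by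
    rw [numExponent_eq hn, dvd_neg, dvd_pow_sub_pow_iff hm hd (hi.le.trans hk)]
    exact Nat.dvd_sub_iff_right (hi.le.trans hk) hmn
  have hnum' : (orderOf ω : ℤ) ∣ (q : ℤ) ^ n + (-(q : ℤ)) ^ (n - k + i) ↔ m ∣ i := by
    rw [numExponent_eq hn, dvd_neg, dvd_pow_sub_pow_iff hm hd (by omega)]
    rw [show n - (n - k + i) = k - i by omega]
    exact Nat.dvd_sub_iff_right hi.le hmk
  have hden : (orderOf ω : ℤ) ∣ (q : ℤ) ^ k - (-1) ^ k * (-(q : ℤ)) ^ i ↔ m ∣ i := by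
    rw [denExponent_eq, IsUnit.dvd_mul_left (IsUnit.pow _ isUnit_neg_one),
      dvd_pow_sub_pow_iff hm hd hi.le]
    exact Nat.dvd_sub_iff_right hi.le hmk
  unfold leadingValue
  simp only [hnum, hnum', hden]
  split_ifs with hki hi' hi'
  · rw [numExponent_eq_mul hn hk]
    push_cast
    field_simp
  · have e1 : ω ^ ((q : ℤ) ^ n + (-(q : ℤ)) ^ (n - k + i)) =
        ω ^ ((q : ℤ) ^ k - (-1) ^ k * (-(q : ℤ)) ^ i) := by
      refine zpow_eq_of_dvd_sub hω ?_
      have hev : Even (n - k) := Nat.Odd.sub_odd hn hki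
      rw [numExponent_eq_mul hn hk, ← hev.neg_pow, ← sub_one_mul]
      exact Dvd.dvd.mul_right hQnk _
    have e2 : ω ^ ((q : ℤ) ^ n + (-(q : ℤ)) ^ i) =
        ω ^ ((q : ℤ) ^ k - (-1) ^ k * (-(q : ℤ)) ^ i) := by
      refine zpow_eq_of_dvd_sub hω ?_
      rw [hn.neg_pow] at hQn
      rw [hki.neg_pow] at hQk
      rw [hki.neg_one_pow]
      obtain ⟨c, hc⟩ := dvd_sub hQk hQn
      exact ⟨c, by linear_combination hc⟩
    rw [e1, e2]
    simp [sq]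
  · rw [Nat.not_odd_iff_even] at hki
    have e1 : ω ^ (2 * ((q : ℤ) ^ k - (-(q : ℤ)) ^ i)) = 1 := by
      rw [hki.neg_one_pow, one_mul] at hden
      rw [zpow_eq_one_iff_dvd]
      exact (hden.2 hi').mul_left _
    rw [e1, numExponent_eq_mul hn hk]
    push_cast
    field_simp
  · rw [Nat.not_odd_iff_even] at hki
    rw [hki.neg_one_pow, one_mul]
    have e1 : ω ^ ((q : ℤ) ^ n + (-(q : ℤ)) ^ (n - k + i)) =
        ω ^ (-((q : ℤ) ^ k - (-(q : ℤ)) ^ i)) := by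
      refine zpow_eq_of_dvd_sub hω ?_
      have hodd : Odd (n - k) := Nat.Odd.sub_even hk hn hki
      rw [hodd.neg_pow] at hQnk
      rw [numExponent_eq_mul hn hk, hki.neg_one_pow]
      obtain ⟨c, hc⟩ := Dvd.dvd.mul_right hQnk (-((q : ℤ) ^ k - (-(q : ℤ)) ^ i))
      exact ⟨c, by linear_combination hc⟩
    have e2 : ω ^ ((q : ℤ) ^ n + (-(q : ℤ)) ^ i) = ω ^ (-((q : ℤ) ^ k - (-(q : ℤ)) ^ i)) := by
      refine zpow_eq_of_dvd_sub hω ?_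
      rw [hn.neg_pow] at hQn
      rw [hki.neg_pow] at hQk
      obtain ⟨c, hc⟩ := dvd_sub hQk hQn
      exact ⟨c, by linear_combination hc⟩
    rw [e1, e2, mul_comm 2, zpow_mul, zpow_neg]
    have hc := zpow_ne_zero ((q : ℤ) ^ k - (-(q : ℤ)) ^ i) h0
    generalize ω ^ ((q : ℤ) ^ k - (-(q : ℤ)) ^ i) = c at hc
    rw [zpow_ofNat]
    field_simp
    ring

lemma prod_range_ite_dvd (hm : 0 < m) (f : ℕ → ℂ) (r : ℕ) :
    ∏ i ∈ range (m * r), (if m ∣ i then f i else 1) = ∏ j ∈ range r, f (m * j) := by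
  rw [← prod_filter]
  refine (prod_bij (fun j _ => m * j) ?_ ?_ ?_ ?_).symm
  · intro j hj
    simp only [mem_range, mem_filter, dvd_mul_right, and_true] at hj ⊢
    exact Nat.mul_lt_mul_of_pos_left hj hm
  · intro j _ j' _ h
    exact Nat.eq_of_mul_eq_mul_left hm h
  · intro i hi
    simp only [mem_range, mem_filter] at hi
    obtain ⟨hi, c, rfl⟩ := hi
    exact ⟨c, mem_range.2 (Nat.lt_of_mul_lt_mul_left hi), rfl⟩
  · intro j _
    rfl

/-- `sievingFunction q n k` is a polynomial with nonnegative integer coefficients. Its values at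
roots of unity `ω` depend on the order `m` of `-q` modulo `orderOf ω`. -/
theorem exists_sieving_polynomial (hq : 2 ≤ q) (hn : Odd n) (hk : k ≤ n) :
    ∃ P : ℕ[X], aeval (RatFunc.X : RatFunc ℚ) P = sievingFunction q n k ∧
      ∀ (ω : ℂ) (m : ℕ), 0 < orderOf ω → 0 < m → m ∣ n →
        (∀ i : ℕ, (orderOf ω : ℤ) ∣ (-(q : ℤ)) ^ i - 1 ↔ m ∣ i) →
        (¬ m ∣ k → aeval ω P = 0) ∧
        ∀ r, k = m * r → aeval ω P = ∏ j ∈ range r, ((q : ℂ) ^ (n - k) *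
          (((q : ℂ) ^ n + (-(q : ℂ)) ^ (m * j)) /
            ((q : ℂ) ^ k - (-1) ^ k * (-(q : ℂ)) ^ (m * j)))) := by
  obtain ⟨P₁, h₁⟩ := exists_polynomial_geometric hq hn hk
  obtain ⟨P₂, h₂⟩ := exists_polynomial_binomial hq hn hk
  obtain ⟨e, he⟩ := Int.eq_ofNat_of_zero_le (sievingExponent_nonneg (k := k) hq)
  refine ⟨X ^ e * P₁ * P₂, ?_, ?_⟩
  · rw [map_mul, map_mul, ← h₁, ← h₂, map_pow, aeval_X, sievingFunction, he]
    simp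
  intro ω m hω hm hmn hd
  have ha : ∀ i < k, 0 < (q : ℤ) ^ n + (-(q : ℤ)) ^ i :=
    fun i hi => numExponent_pos hq (hi.trans_le hk)
  have ha' : ∀ i < k, 0 < (q : ℤ) ^ n + (-(q : ℤ)) ^ (n - k + i) :=
    fun i hi => numExponent_pos hq (by omega)
  have hb : ∀ i < k, 0 < (q : ℤ) ^ k - (-1) ^ k * (-(q : ℤ)) ^ i :=
    fun i hi => denExponent_pos hq hi
  have card_num : #{i ∈ range k | (orderOf ω : ℤ) ∣ (q : ℤ) ^ n + (-(q : ℤ)) ^ i} =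
      #{i ∈ range k | m ∣ i} := by
    congr 1
    refine filter_congr fun i hi => ?_
    have hi := mem_range.1 hi
    rw [numExponent_eq hn, dvd_neg, dvd_pow_sub_pow_iff hm hd (by omega)]
    exact Nat.dvd_sub_iff_right (by omega) hmn
  have card_num' :
      #{i ∈ range k | (orderOf ω : ℤ) ∣ (q : ℤ) ^ n + (-(q : ℤ)) ^ (n - k + i)} = k / m := by
    rw [← card_filter_dvd_sub]
    congr 1
    refine filter_congr fun i hi => ?_
    have hi := mem_range.1 hi
    rw [numExponent_eq hn, dvd_neg, dvd_pow_sub_pow_iff hm hd (by omega)]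
    rw [show n - (n - k + i) = k - i by omega]
  have card_den :
      #{i ∈ range k | (orderOf ω : ℤ) ∣ (q : ℤ) ^ k - (-1) ^ k * (-(q : ℤ)) ^ i} = k / m := by
    rw [← card_filter_dvd_sub]
    congr 1
    refine filter_congr fun i hi => ?_
    rw [denExponent_eq, IsUnit.dvd_mul_left (IsUnit.pow _ isUnit_neg_one),
      dvd_pow_sub_pow_iff hm hd (mem_range.1 hi).le]
  constructor
  · intro hmk
    have h0 : aeval ω P₂ = 0 := by
      refine aeval_eq_zero_of_card_lt hω ha hb h₂ ?_
      rw [card_num, card_den, card_filter_dvd_of_not_dvd hmk]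
      exact Nat.lt_succ_self _
    rw [map_mul, h0, mul_zero]
  · rintro r hr
    have hmk : m ∣ k := ⟨r, hr⟩
    have hfil : #{i ∈ range k | m ∣ i} = k / m := by
      rw [← card_filter_dvd_sub]
      congr 1
      refine filter_congr fun i hi => ?_
      exact (Nat.dvd_sub_iff_right (mem_range.1 hi).le hmk).symm
    have v₁ := aeval_mul_prod_leadingValue hω ha' hb h₁ (card_num'.trans card_den.symm)
    have v₂ := aeval_mul_prod_leadingValue hω ha hb h₂
      ((card_num.trans hfil).trans card_den.symm)
    have hB : ∏ i ∈ range k, leadingValue ω ((q : ℤ) ^ k - (-1) ^ k * (-(q : ℤ)) ^ i) ≠ 0 :=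
      prod_ne_zero_iff.2 fun i hi => leadingValue_ne_zero hω (hb i (mem_range.1 hi))
    have hE : ω ^ e = ∏ i ∈ range k,
        ω ^ (if Odd k then 0 else 2 * ((q : ℤ) ^ k - (-(q : ℤ)) ^ i)) := by
      have h0 : ω ≠ 0 := by rintro rfl; simp at hω
      have hsum : ∀ s : Finset ℕ, ∀ g : ℕ → ℤ, ∏ i ∈ s, ω ^ g i = ω ^ ∑ i ∈ s, g i := by
        intro s g
        induction s using Finset.induction_on with
        | empty => simp
        | insert a s ha ih => rw [prod_insert ha, sum_insert ha, ih, zpow_add₀ h0]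
      rw [hsum, ← zpow_natCast, ← he, sievingExponent]
      split_ifs
      · simp
      · rw [mul_sum]
    have key : ω ^ e * ((∏ i ∈ range k, leadingValue ω ((q : ℤ) ^ n + (-(q : ℤ)) ^ (n - k + i))) *
        ∏ i ∈ range k, leadingValue ω ((q : ℤ) ^ n + (-(q : ℤ)) ^ i)) =
        (∏ i ∈ range k, leadingValue ω ((q : ℤ) ^ k - (-1) ^ k * (-(q : ℤ)) ^ i)) ^ 2 *
        ∏ i ∈ range k, (if m ∣ i then (q : ℂ) ^ (n - k) * (((q : ℂ) ^ n + (-(q : ℂ)) ^ i) /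
          ((q : ℂ) ^ k - (-1) ^ k * (-(q : ℂ)) ^ i)) else 1) := by
      rw [hE, ← prod_mul_distrib, ← prod_mul_distrib, ← prod_pow, ← prod_mul_distrib]
      exact prod_congr rfl fun i hi =>
        leadingValue_mul_leadingValue hq hn hk hω hm hmn hmk hd (mem_range.1 hi)
    rw [← v₁, ← v₂] at key
    apply mul_left_cancel₀ (pow_ne_zero 2 hB)
    have hprod := prod_range_ite_dvd hm (fun i => (q : ℂ) ^ (n - k) *
      (((q : ℂ) ^ n + (-(q : ℂ)) ^ i) / ((q : ℂ) ^ k - (-1) ^ k * (-(q : ℂ)) ^ i))) r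
    rw [← hr] at hprod
    rw [hprod] at key
    rw [← key, map_mul, map_mul, map_pow, aeval_X]
    ring

end Evaluation

end NegativeQBinomial

namespace FiniteHermitian

open Finset

section Norm

variable {K : Type*} [Field K] {q : ℕ}

lemma exists_pow_succ_eq_and_primitive (hK : Nat.card K = q ^ 2) (hq : 2 ≤ q) :
    (∃ ζ : K, IsPrimitiveRoot ζ (q + 1)) ∧
      ∀ c : K, c ≠ 0 → c ^ q = c → ∃ a : K, a ^ (q + 1) = c := by
  have : Finite K := Nat.finite_of_card_ne_zero (by rw [hK]; positivity)
  obtain ⟨g, hg⟩ := IsCyclic.exists_generator (α := Kˣ)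
  have hcard : Nat.card Kˣ = (q - 1) * (q + 1) := by
    rw [Nat.card_units, hK]
    obtain ⟨r, rfl⟩ : ∃ r, q = r + 1 := ⟨q - 1, by omega⟩
    rw [Nat.add_sub_cancel]
    apply Nat.sub_eq_of_eq_add
    ring
  have hord : orderOf g = (q - 1) * (q + 1) := by
    rw [orderOf_eq_card_of_forall_mem_zpowers hg, hcard]
  have hpos : 0 < q - 1 := by omega
  constructor
  · have h1 : IsPrimitiveRoot g ((q - 1) * (q + 1)) := hord ▸ IsPrimitiveRoot.orderOf g
    have h2 := (IsPrimitiveRoot.coe_units_iff.2 h1).pow (by positivity) rfl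
    exact ⟨_, h2⟩
  · intro c hc0 hc
    obtain ⟨t, ht⟩ := (Submonoid.mem_powers_iff (Units.mk0 c hc0) g).1
      ((mem_powers_iff_mem_zpowers).2 (hg (Units.mk0 c hc0)))
    have h1 : (Units.mk0 c hc0) ^ (q - 1) = 1 := by
      ext
      rw [Units.val_pow_eq_pow_val, Units.val_mk0, Units.val_one]
      apply mul_right_cancel₀ hc0
      rw [← pow_succ, Nat.sub_add_cancel (by omega), hc, one_mul]
    rw [← ht, ← pow_mul, ← orderOf_dvd_iff_pow_eq_one, hord, mul_comm] at h1
    obtain ⟨s, rfl⟩ := Nat.dvd_of_mul_dvd_mul_right hpos h1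
    refine ⟨(g ^ s : Kˣ), ?_⟩
    rw [← Units.val_pow_eq_pow_val, ← pow_mul, mul_comm, ht, Units.val_mk0]

lemma card_pow_succ_eq [Fintype K] [DecidableEq K] (hK : Nat.card K = q ^ 2) (hq : 2 ≤ q) {c : K}
    (hc0 : c ≠ 0) (hc : c ^ q = c) : #{a : K | a ^ (q + 1) = c} = q + 1 := by
  obtain ⟨⟨ζ, hζ⟩, h⟩ := exists_pow_succ_eq_and_primitive hK hq
  have h1 := hζ.card_nthRoots c
  rw [if_pos (h c hc0 hc)] at h1
  refine Eq.trans ?_ ((Multiset.toFinset_card_of_nodup (hζ.nthRoots_nodup hc0)).trans h1)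
  congr 1
  ext a
  simp [Polynomial.mem_nthRoots]

end Norm

variable {K V : Type*} [Field K] [AddCommGroup V] [Module K V]

/-- A Hermitian form over a field with `q ^ 2` elements, whose involution is `a ↦ a ^ q`. -/
structure IsHermitianForm (q : ℕ) (h : V → V → K) : Prop where
  add_left : ∀ x y z, h (x + y) z = h x z + h y z
  add_right : ∀ x y z, h x (y + z) = h x y + h x z
  smul_left : ∀ (a : K) x y, h (a • x) y = a * h x y
  conj : ∀ x y, h y x = h x y ^ q

/-- The restriction of `h` to `W` is nondegenerate. -/
def IsNondegenerateOn (h : V → V → K) (W : Submodule K V) : Prop :=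
  ∀ x ∈ W, (∀ y ∈ W, h x y = 0) → x = 0

namespace IsHermitianForm

variable {q : ℕ} {h : V → V → K}

lemma smul_right (H : IsHermitianForm q h) (a : K) (x y : V) :
    h x (a • y) = a ^ q * h x y := by
  rw [H.conj (a • y) x, H.smul_left, mul_pow, ← H.conj]

lemma zero_left (H : IsHermitianForm q h) (y : V) : h 0 y = 0 := by
  simpa using H.smul_left 0 0 y

lemma eq_zero_symm (H : IsHermitianForm q h) (hq : 2 ≤ q) {x y : V} (hxy : h x y = 0) :
    h y x = 0 := by
  rw [H.conj, hxy, zero_pow (by omega)]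

lemma sub_left (H : IsHermitianForm q h) (x y z : V) : h (x - y) z = h x z - h y z := by
  have := H.add_left (x - y) y z
  rw [sub_add_cancel] at this
  rw [this, add_sub_cancel_right]

lemma neg_one_pow (H : IsHermitianForm q h) {v : V} (hvv : h v v ≠ 0) : (-1 : K) ^ q = -1 := by
  have h1 := H.add_right v v ((-1 : K) • v)
  have h2 : h v 0 = 0 := by
    have := H.add_right v 0 0
    rw [add_zero] at this
    exact left_eq_add.1 this
  rw [neg_one_smul, add_neg_cancel, h2, ← neg_one_smul K v, H.smul_right] at h1
  apply mul_right_cancel₀ hvv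
  linear_combination -h1

/-- The vectors orthogonal to `v`. -/
def perp (H : IsHermitianForm q h) (v : V) : Submodule K V where
  carrier := {x | h x v = 0}
  add_mem' := fun {x y} hx hy => by
    change h (x + y) v = 0
    rw [H.add_left, show h x v = 0 from hx, show h y v = 0 from hy, add_zero]
  zero_mem' := H.zero_left v
  smul_mem' := fun a x hx => by
    change h (a • x) v = 0
    rw [H.smul_left, show h x v = 0 from hx, mul_zero]

lemma mem_perp (H : IsHermitianForm q h) {v x : V} : x ∈ H.perp v ↔ h x v = 0 := Iff.rfl

/-- The orthogonal decomposition of `W` with respect to an anisotropic vector `v ∈ W`. -/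
def decomposition (H : IsHermitianForm q h) {W : Submodule K V} {v : V} (hv : v ∈ W)
    (hvv : h v v ≠ 0) : K × ↥(W ⊓ H.perp v) ≃ W where
  toFun p := ⟨p.1 • v + p.2, W.add_mem (W.smul_mem _ hv) p.2.2.1⟩
  invFun w := (h w v / h v v, ⟨w - (h w v / h v v) • v, W.sub_mem w.2 (W.smul_mem _ hv), by
    change h _ _ = 0
    rw [H.sub_left, H.smul_left, div_mul_cancel₀ _ hvv, sub_self]⟩)
  left_inv := by
    rintro ⟨a, x, hxW, hx⟩
    have h1 : h (a • v + x) v / h v v = a := by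
      rw [H.add_left, H.smul_left, H.mem_perp.1 hx, add_zero, mul_div_cancel_right₀ _ hvv]
    ext <;> simp [h1]
  right_inv := by
    rintro ⟨w, hw⟩
    simp

lemma finrank_inf_perp (H : IsHermitianForm q h) [Finite K] [Module.Finite K V]
    {W : Submodule K V} {v : V} (hv : v ∈ W) (hvv : h v v ≠ 0) :
    Module.finrank K ↥(W ⊓ H.perp v) + 1 = Module.finrank K W := by
  have h1 := Nat.card_congr (H.decomposition hv hvv)
  rw [Nat.card_prod, Module.natCard_eq_pow_finrank (K := K) (V := W),
    Module.natCard_eq_pow_finrank (K := K) (V := ↥(W ⊓ H.perp v)), ← pow_succ'] at h1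
  exact Nat.pow_right_injective Finite.one_lt_card h1

lemma isNondegenerateOn_inf_perp (H : IsHermitianForm q h) {W : Submodule K V}
    (hW : IsNondegenerateOn h W) {v : V} (hv : v ∈ W) (hvv : h v v ≠ 0) :
    IsNondegenerateOn h (W ⊓ H.perp v) := by
  rintro x ⟨hxW, hx⟩ hy
  refine hW x hxW fun w hw => ?_
  obtain ⟨⟨a, w'⟩, hw'⟩ := (H.decomposition hv hvv).surjective ⟨w, hw⟩
  have h1 : a • v + (w' : V) = w := congrArg Subtype.val hw'
  rw [← h1, H.add_right, H.smul_right, H.mem_perp.1 hx, hy _ w'.2, mul_zero, add_zero]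

lemma isNondegenerateOn_sup_span (H : IsHermitianForm q h) {W : Submodule K V}
    (hW : IsNondegenerateOn h W) {v : V} (hvv : h v v ≠ 0) (hWv : W ≤ H.perp v) :
    IsNondegenerateOn h (W ⊔ K ∙ v) := by
  intro x hx hy
  obtain ⟨w, hw, z, hz, rfl⟩ := Submodule.mem_sup.1 hx
  obtain ⟨a, rfl⟩ := Submodule.mem_span_singleton.1 hz
  have ha : a = 0 := by
    have h1 := hy v (Submodule.mem_sup_right (Submodule.mem_span_singleton_self v))
    rw [H.add_left, H.mem_perp.1 (hWv hw), zero_add, H.smul_left] at h1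
    exact (mul_eq_zero.1 h1).resolve_right hvv
  subst ha
  rw [zero_smul, add_zero]
  refine hW w hw fun y hyW => ?_
  simpa using hy y (Submodule.mem_sup_left hyW)

lemma sup_span_inf_perp (H : IsHermitianForm q h) {W : Submodule K V} {v : V} (hvv : h v v ≠ 0)
    (hWv : W ≤ H.perp v) : (W ⊔ K ∙ v) ⊓ H.perp v = W := by
  refine le_antisymm ?_ (le_inf le_sup_left hWv)
  rintro x ⟨hx, hxv⟩
  obtain ⟨w, hw, z, hz, rfl⟩ := Submodule.mem_sup.1 hx
  obtain ⟨a, rfl⟩ := Submodule.mem_span_singleton.1 hz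
  have h1 := H.mem_perp.1 hxv
  rw [H.add_left, H.mem_perp.1 (hWv hw), zero_add, H.smul_left] at h1
  rw [(mul_eq_zero.1 h1).resolve_right hvv, zero_smul, add_zero]
  exact hw

lemma inf_perp_sup_span (H : IsHermitianForm q h) {W : Submodule K V} {v : V} (hv : v ∈ W)
    (hvv : h v v ≠ 0) : (W ⊓ H.perp v) ⊔ K ∙ v = W := by
  refine le_antisymm (sup_le inf_le_left ((Submodule.span_singleton_le_iff_mem v W).2 hv)) ?_
  intro w hw
  obtain ⟨⟨a, w'⟩, hw'⟩ := (H.decomposition hv hvv).surjective ⟨w, hw⟩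
  have h1 : a • v + (w' : V) = w := congrArg Subtype.val hw'
  rw [← h1, add_comm]
  exact Submodule.add_mem_sup w'.2 (Submodule.smul_mem _ _ (Submodule.mem_span_singleton_self v))

lemma exists_anisotropic (H : IsHermitianForm q h) (hK : Nat.card K = q ^ 2) (hq : 2 ≤ q)
    {W : Submodule K V} (hW : IsNondegenerateOn h W) (hW0 : W ≠ ⊥) :
    ∃ v ∈ W, h v v ≠ 0 := by
  by_contra! hcon
  obtain ⟨x, hx, hx0⟩ := W.ne_bot_iff.1 hW0
  refine hx0 (hW x hx fun y hy => ?_)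
  by_contra hxy
  have key : ∀ t : K, t + t ^ q = 0 := by
    intro t
    have h1 := hcon ((t / h x y) • x + y) (W.add_mem (W.smul_mem _ hx) hy)
    rw [H.add_left, H.add_right, H.add_right, hcon y hy, hcon _ (W.smul_mem _ hx),
      H.conj ((t / h x y) • x) y, H.smul_left, div_mul_cancel₀ _ hxy, zero_add, add_zero] at h1
    exact h1
  have hfin : Finite K := Nat.finite_of_card_ne_zero (by rw [hK]; positivity)
  have := Fintype.ofFinite K
  have hdeg : (Polynomial.X ^ q + Polynomial.X : Polynomial K).natDegree = q := by
    rw [Polynomial.natDegree_add_eq_left_of_natDegree_lt] <;> simp; omega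
  have hne : (Polynomial.X ^ q + Polynomial.X : Polynomial K) ≠ 0 := by
    intro h0
    rw [h0, Polynomial.natDegree_zero] at hdeg
    omega
  have hroots : Fintype.card K ≤ q := by
    rw [← hdeg]
    refine Polynomial.card_le_degree_of_subset_roots (Z := Finset.univ) fun t _ => ?_
    rw [Polynomial.mem_roots hne]
    simpa [add_comm] using key t
  rw [← Nat.card_eq_fintype_card, hK] at hroots
  nlinarith

/-- The number of anisotropic vectors of `W`. -/
noncomputable def anisotropicCard (h : V → V → K) (W : Submodule K V) : ℕ :=
  Nat.card {w : W // h w w ≠ 0}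

open Classical in
lemma anisotropicCard_eq_add (H : IsHermitianForm q h) (hK : Nat.card K = q ^ 2) (hq : 2 ≤ q)
    [Module.Finite K V] {W : Submodule K V} {v : V} (hv : v ∈ W) (hvv : h v v ≠ 0) :
    anisotropicCard h W + q * anisotropicCard h (W ⊓ H.perp v) + Nat.card ↥(W ⊓ H.perp v) =
      Nat.card W := by
  have hfin : Finite K := Nat.finite_of_card_ne_zero (by rw [hK]; positivity)
  have : Finite V := Module.finite_of_finite K
  have := Fintype.ofFinite K
  have := Fintype.ofFinite V
  set W' := W ⊓ H.perp v with hW'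
  have hval : ∀ p : K × W', h (H.decomposition hv hvv p : V) (H.decomposition hv hvv p : V) =
      p.1 ^ (q + 1) * h v v + h p.2 p.2 := by
    rintro ⟨a, x, hxW, hx⟩
    change h (a • v + x) (a • v + x) = a ^ (q + 1) * h v v + h x x
    have h1 := H.mem_perp.1 hx
    rw [H.add_left, H.add_right, H.add_right, H.smul_left, H.smul_left, H.smul_right, H.smul_right,
      h1, H.eq_zero_symm hq h1]
    ring
  have hiso : Nat.card {w : W // h w w = 0} =
      Nat.card {w : W' // h w w = 0} + (q + 1) * anisotropicCard h W' := by
    have e : {p : K × W' // p.1 ^ (q + 1) * h v v + h p.2 p.2 = 0} ≃ {w : W // h w w = 0} :=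
      (H.decomposition hv hvv).subtypeEquiv fun p => by rw [hval]
    rw [← Nat.card_congr e, anisotropicCard]
    simp only [Nat.card_eq_fintype_card, Fintype.card_subtype]
    rw [card_filter, Fintype.sum_prod_type_right, card_filter, card_filter, mul_sum,
      ← sum_add_distrib]
    refine sum_congr rfl fun w _ => ?_
    rw [← card_filter]
    by_cases hw : h w w = 0
    · simp only [hw, add_zero, mul_eq_zero, hvv, or_false, pow_eq_zero_iff, ne_eq,
        Nat.add_eq_zero_iff, one_ne_zero, and_false, not_false_eq_true, not_true_eq_false,
        if_true, if_false, mul_zero]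
      exact card_eq_one.2 ⟨0, by ext a; simp⟩
    · have hc0 : -h w w / h v v ≠ 0 := div_ne_zero (neg_ne_zero.2 hw) hvv
      have hc : (-h w w / h v v) ^ q = -h w w / h v v := by
        rw [div_pow, neg_pow, H.neg_one_pow hvv, ← H.conj, ← H.conj, neg_one_mul]
      rw [if_neg hw, if_pos hw, zero_add, mul_one]
      refine Eq.trans ?_ (card_pow_succ_eq hK hq hc0 hc)
      congr 1
      ext a
      simp only [mem_filter, mem_univ, true_and]
      rw [eq_div_iff hvv, eq_neg_iff_add_eq_zero]
  have hsplit : ∀ U : Submodule K V,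
      Nat.card U = Nat.card {w : U // h w w = 0} + anisotropicCard h U := by
    intro U
    rw [anisotropicCard, ← Nat.card_sum]
    exact Nat.card_congr (Equiv.sumCompl _).symm
  rw [hsplit W, hsplit W', hiso]
  ring

lemma mul_anisotropicCard (H : IsHermitianForm q h) (hK : Nat.card K = q ^ 2) (hq : 2 ≤ q)
    [Module.Finite K V] (r : ℕ) : ∀ W : Submodule K V, IsNondegenerateOn h W →
    Module.finrank K W = r →
    (-(q : ℤ)) * anisotropicCard h W =
      (-(q : ℤ) + 1) * (-(q : ℤ)) ^ r * ((-(q : ℤ)) ^ r - 1) := by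
  have hfin : Finite K := Nat.finite_of_card_ne_zero (by rw [hK]; positivity)
  induction r with
  | zero =>
    intro W _ hr
    have h0 : W = ⊥ := Submodule.finrank_eq_zero.1 hr
    have : IsEmpty {w : W // h w w ≠ 0} := by
      refine ⟨fun w => w.2 ?_⟩
      have : (w.1 : V) = 0 := (Submodule.mem_bot K).1 (h0.le w.1.2)
      rw [this, H.zero_left]
    simp [anisotropicCard]
  | succ r ih =>
    intro W hW hr
    have hW0 : W ≠ ⊥ := by rintro rfl; simp at hr
    obtain ⟨v, hv, hvv⟩ := H.exists_anisotropic hK hq hW hW0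
    have h1 := H.finrank_inf_perp hv hvv
    have h2 := ih _ (H.isNondegenerateOn_inf_perp hW hv hvv) (by omega)
    have h3 := H.anisotropicCard_eq_add hK hq hv hvv
    rw [Module.natCard_eq_pow_finrank (K := K) (V := W),
      Module.natCard_eq_pow_finrank (K := K) (V := ↥(W ⊓ H.perp v)), hr, hK,
      show Module.finrank K ↥(W ⊓ H.perp v) = r by omega] at h3
    have h4 : (anisotropicCard h W : ℤ) + q * anisotropicCard h (W ⊓ H.perp v) + ((q : ℤ) ^ 2) ^ r =
      ((q : ℤ) ^ 2) ^ (r + 1) := by exact_mod_cast h3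
    have h5 : ((q : ℤ) ^ 2) ^ r = ((-(q : ℤ)) ^ r) ^ 2 := by
      rw [← neg_sq, ← pow_mul, ← pow_mul, mul_comm]
    rw [pow_succ _ r, h5] at h4
    rw [pow_succ]
    linear_combination (-(q : ℤ)) * h4 - (q : ℤ) * h2

/-- The nondegenerate `k`-dimensional subspaces of `U`. -/
def subspacesIn (h : V → V → K) (U : Submodule K V) (k : ℕ) : Set (Submodule K V) :=
  {W | W ≤ U ∧ Module.finrank K W = k ∧ IsNondegenerateOn h W}

lemma ncard_subspacesIn_mem (H : IsHermitianForm q h) [Finite K] [Module.Finite K V]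
    {U : Submodule K V} {v : V} (hv : v ∈ U) (hvv : h v v ≠ 0) (k : ℕ) :
    {W ∈ subspacesIn h U (k + 1) | v ∈ W}.ncard = (subspacesIn h (U ⊓ H.perp v) k).ncard := by
  refine Set.ncard_congr (fun W _ => W ⊓ H.perp v) ?_ ?_ ?_
  · rintro W ⟨⟨hWU, hWk, hW⟩, hvW⟩
    have := H.finrank_inf_perp hvW hvv
    exact ⟨inf_le_inf_right _ hWU, by omega, H.isNondegenerateOn_inf_perp hW hvW hvv⟩
  · rintro W W' ⟨_, hvW⟩ ⟨_, hvW'⟩ hWW'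
    rw [← H.inf_perp_sup_span hvW hvv, hWW', H.inf_perp_sup_span hvW' hvv]
  · rintro W ⟨hWU, hWk, hW⟩
    have hWv := hWU.trans inf_le_right
    have hvW : v ∈ W ⊔ K ∙ v := Submodule.mem_sup_right (Submodule.mem_span_singleton_self v)
    have h1 := H.finrank_inf_perp hvW hvv
    rw [H.sup_span_inf_perp hvv hWv] at h1
    refine ⟨W ⊔ K ∙ v, ⟨⟨sup_le (hWU.trans inf_le_left)
      ((Submodule.span_singleton_le_iff_mem v U).2 hv), by omega,
      H.isNondegenerateOn_sup_span hW hvv hWv⟩, hvW⟩, H.sup_span_inf_perp hvv hWv⟩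

open Classical in
/-- Counting pairs of a nondegenerate subspace and an anisotropic vector in it. -/
lemma sum_anisotropicCard (H : IsHermitianForm q h) [Fintype V] [Fintype (Submodule K V)]
    [Finite K] (U : Submodule K V) (k : ℕ) :
    ∑ W ∈ (subspacesIn h U (k + 1)).toFinset, anisotropicCard h W =
      ∑ v : V with v ∈ U ∧ h v v ≠ 0, (subspacesIn h (U ⊓ H.perp v) k).ncard := by
  have := Module.Finite.of_finite (R := K) (M := V)
  have key := sum_card_bipartiteAbove_eq_sum_card_bipartiteBelow
    (s := (subspacesIn h U (k + 1)).toFinset)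
    (t := {v : V | v ∈ U ∧ h v v ≠ 0}) (r := fun W v => v ∈ W)
  convert key using 2 with W hW v hv
  · have hWU := (Set.mem_toFinset.1 hW).1
    have e : {w : W // h w w ≠ 0} ≃ {v : V // v ∈ ({v : V | (v ∈ U ∧ h v v ≠ 0) ∧ v ∈ W} :
        Finset V)} :=
      { toFun := fun w => ⟨w.1, by simpa using ⟨hWU w.1.2, w.2⟩⟩
        invFun := fun w => ⟨⟨w.1, (mem_filter.1 w.2).2.2⟩, (mem_filter.1 w.2).2.1.2⟩
        left_inv := fun w => rfl
        right_inv := fun w => rfl }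
    rw [anisotropicCard, Nat.card_congr e, Nat.card_eq_fintype_card, Fintype.card_coe,
      bipartiteAbove, filter_filter]
  · have hv := (mem_filter.1 hv).2
    rw [← H.ncard_subspacesIn_mem hv.1 hv.2, Set.ncard_eq_toFinset_card', bipartiteBelow]
    congr 1
    ext W
    simp

theorem ncard_subspacesIn (H : IsHermitianForm q h) (hK : Nat.card K = q ^ 2) (hq : 2 ≤ q)
    [Module.Finite K V] (k : ℕ) : ∀ (U : Submodule K V) (m : ℕ), IsNondegenerateOn h U →
    Module.finrank K U = m →
    ((subspacesIn h U k).ncard : ℤ) *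
      ∏ j ∈ range k, (-(q : ℤ)) ^ (k - j) * ((-(q : ℤ)) ^ (k - j) - 1) =
      ∏ j ∈ range k, (-(q : ℤ)) ^ (m - j) * ((-(q : ℤ)) ^ (m - j) - 1) := by
  classical
  have hfin : Finite K := Nat.finite_of_card_ne_zero (by rw [hK]; positivity)
  have : Finite V := Module.finite_of_finite K
  have := Fintype.ofFinite V
  have := Fintype.ofFinite (Submodule K V)
  induction k with
  | zero =>
    intro U m _ _
    have h1 : subspacesIn h U 0 = {⊥} := by
      ext W
      simp only [subspacesIn, Set.mem_ofPred_eq, Set.mem_singleton_iff]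
      constructor
      · rintro ⟨_, hW, _⟩
        exact Submodule.finrank_eq_zero.1 hW
      · rintro rfl
        exact ⟨bot_le, finrank_bot K V, fun x hx _ => by simpa using hx⟩
    simp [h1]
  | succ k ih =>
    intro U m hU hm
    have hcoef : (-(q : ℤ) + 1) ≠ 0 := by
      have : (2 : ℤ) ≤ q := by exact_mod_cast hq
      linarith
    have h1 := H.sum_anisotropicCard U k
    have h2 : ∀ v ∈ ({v : V | v ∈ U ∧ h v v ≠ 0} : Finset V),
        ((subspacesIn h (U ⊓ H.perp v) k).ncard : ℤ) *
          ∏ j ∈ range k, (-(q : ℤ)) ^ (k - j) * ((-(q : ℤ)) ^ (k - j) - 1) =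
        ∏ j ∈ range k, (-(q : ℤ)) ^ (m - 1 - j) * ((-(q : ℤ)) ^ (m - 1 - j) - 1) := by
      intro v hv
      have hv := (mem_filter.1 hv).2
      have := H.finrank_inf_perp hv.1 hv.2
      exact ih _ _ (H.isNondegenerateOn_inf_perp hU hv.1 hv.2) (by omega)
    have h3 := sum_congr rfl h2
    rw [← sum_mul, sum_const] at h3
    have hcard : #{v : V | v ∈ U ∧ h v v ≠ 0} = anisotropicCard h U := by
      have e : {w : U // h w w ≠ 0} ≃ {v : V // v ∈ U ∧ h v v ≠ 0} :=
        Equiv.subtypeSubtypeEquivSubtypeInter (fun v => v ∈ U) (fun v => h v v ≠ 0)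
      rw [anisotropicCard, Nat.card_congr e, Nat.card_eq_fintype_card, Fintype.card_subtype]
    rw [hcard, ← Nat.cast_sum, ← h1, nsmul_eq_mul] at h3
    have h4 : (-(q : ℤ)) * ((∑ W ∈ (subspacesIn h U (k + 1)).toFinset, anisotropicCard h W : ℕ) : ℤ)
        = (subspacesIn h U (k + 1)).ncard *
          ((-(q : ℤ) + 1) * (-(q : ℤ)) ^ (k + 1) * ((-(q : ℤ)) ^ (k + 1) - 1)) := by
      rw [Nat.cast_sum, mul_sum, Set.ncard_eq_toFinset_card', ← nsmul_eq_mul, ← sum_const]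
      refine sum_congr rfl fun W hW => ?_
      have hW := Set.mem_toFinset.1 hW
      exact H.mul_anisotropicCard hK hq _ W hW.2.2 hW.2.1
    have h5 := H.mul_anisotropicCard hK hq m U hU hm
    rw [prod_range_succ', prod_range_succ']
    simp only [Nat.add_sub_add_right, Nat.sub_zero]
    simp only [Nat.sub_sub, add_comm 1] at h3
    apply mul_left_cancel₀ hcoef
    linear_combination (-(q : ℤ)) * h3 -
      (∏ j ∈ range k, (-(q : ℤ)) ^ (k - j) * ((-(q : ℤ)) ^ (k - j) - 1)) * h4 +
      (∏ j ∈ range k, (-(q : ℤ)) ^ (m - (j + 1)) * ((-(q : ℤ)) ^ (m - (j + 1)) - 1)) * h5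

end IsHermitianForm

section TraceForm

variable {q n : ℕ} {L : Type*} [Field L]

lemma exists_charP_pow_eq (hq : IsPrimePow q) (hL : Nat.card L = q ^ (2 * n)) :
    ∃ p e : ℕ, q ^ n = p ^ e ∧ p.Prime ∧ CharP L p := by
  obtain ⟨p, e, hp, _, rfl⟩ := hq
  have hp' : Nat.Prime p := hp.nat_prime
  have : Fact p.Prime := ⟨hp'⟩
  have hfin : Finite L := Nat.finite_of_card_ne_zero (by
    rw [hL]; exact pow_ne_zero _ (pow_ne_zero _ hp'.ne_zero))
  have := Fintype.ofFinite L
  rw [Nat.card_eq_fintype_card, ← pow_mul] at hL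
  exact ⟨p, e * n, by rw [pow_mul], hp', charP_of_card_eq_prime_pow hL⟩

lemma pow_pow_self (hL : Nat.card L = q ^ (2 * n)) [Finite L] (x : L) :
    (x ^ q ^ n) ^ q ^ n = x := by
  have := Fintype.ofFinite L
  rw [← pow_mul, ← pow_add, ← two_mul, ← hL, Nat.card_eq_fintype_card, FiniteField.pow_card]

variable (M : Type*) [Field M] [Algebra M L] [Finite L]

lemma trace_pow (hq : IsPrimePow q) (hL : Nat.card L = q ^ (2 * n)) (x : L) :
    Algebra.trace M L (x ^ q ^ n) = Algebra.trace M L x ^ q ^ n := by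
  obtain ⟨p, e, hpe, hp, hchar⟩ := exists_charP_pow_eq hq hL
  have : Fact p.Prime := ⟨hp⟩
  apply FaithfulSMul.algebraMap_injective M L
  rw [map_pow (algebraMap M L), FiniteField.algebraMap_trace_eq_sum_pow, FiniteField.algebraMap_trace_eq_sum_pow,
    hpe, sum_pow_char_pow]
  exact sum_congr rfl fun i _ => by rw [← pow_mul, ← pow_mul, mul_comm]

variable {M}

lemma pow_pow_eq_pow {m s : ℕ} [Finite M] (hM : Nat.card M = (q ^ m) ^ 2)
    (hn : n = m * (2 * s + 1)) (a : M) : a ^ q ^ n = a ^ q ^ m := by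
  have := Fintype.ofFinite M
  have h1 := FiniteField.pow_card_pow s a
  rw [← Nat.card_eq_fintype_card, hM] at h1
  rw [hn, pow_mul, pow_succ, pow_mul, pow_mul, h1]

theorem isHermitianForm_traceForm (hq : IsPrimePow q) {m s : ℕ}
    (hL : Nat.card L = q ^ (2 * n)) (hM : Nat.card M = (q ^ m) ^ 2) (hn : n = m * (2 * s + 1)) :
    IsHermitianForm (q ^ m) (traceForm q n M : L → L → M) where
  add_left x y z := by simp only [traceForm, add_mul, map_add]
  add_right x y z := by
    obtain ⟨p, e, hpe, hp, hchar⟩ := exists_charP_pow_eq hq hL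
    have : Fact p.Prime := ⟨hp⟩
    simp only [traceForm]
    rw [hpe, add_pow_char_pow, mul_add, map_add]
  smul_left a x y := by simp only [traceForm, smul_mul_assoc, map_smul, smul_eq_mul]
  conj x y := by
    have := Finite.of_injective _ (FaithfulSMul.algebraMap_injective M L)
    simp only [traceForm]
    rw [← pow_pow_eq_pow hM hn, ← trace_pow M hq hL, mul_pow,
      pow_pow_self hL, mul_comm]

theorem isNondegenerateOn_traceForm_top (hL : Nat.card L = q ^ (2 * n)) :
    IsNondegenerateOn (traceForm q n M : L → L → M) ⊤ := by
  have := Finite.of_injective _ (FaithfulSMul.algebraMap_injective M L)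
  intro x _ hx
  refine (traceForm_nondegenerate M L).1 x fun y => ?_
  have h1 := hx (y ^ q ^ n) trivial
  rwa [traceForm, pow_pow_self hL] at h1

end TraceForm

lemma traceForm_mul_mul {q n : ℕ} {K L : Type*} [Field K] [Field L] [Algebra K L] {c : L}
    (hc : c ^ (q ^ n + 1) = 1) (x y : L) :
    traceForm q n K (c * x) (c * y) = traceForm q n K x y := by
  simp only [traceForm]
  congr 1
  rw [mul_pow]
  linear_combination (x * y ^ q ^ n) * hc

lemma smul_mem_nondegenerateSubspaces {q n k : ℕ} {K L : Type*} [Field K]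
    [Field L] [Algebra K L] {C : Subgroup Lˣ} (c : C)
    (hc : ((c : Lˣ) : L) ^ (q ^ n + 1) = 1) {W : Submodule K L}
    (hW : W ∈ nondegenerateSubspaces q n k K L) : c • W ∈ nondegenerateSubspaces q n k K L := by
  refine ⟨?_, ?_⟩
  · rw [← hW.1]
    exact (LinearEquiv.finrank_eq (Submodule.equivMapOfInjective
      (DistribSMul.toLinearMap K L c) (MulAction.injective c) W)).symm
  · intro y hy h
    obtain ⟨x, hx, rfl⟩ := (Submodule.mem_smul_pointwise_iff_exists _ _ _).1 hy
    have h1 : x = 0 := by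
      refine hW.2 x hx fun z hz => ?_
      have h2 := h (c • z) (Submodule.smul_mem_pointwise_smul z c W hz)
      rwa [← traceForm_mul_mul hc]
    rw [h1, smul_zero]

section Restriction

variable {q n : ℕ} {K L M : Type*} [Field K] [Field L] [Field M] [Algebra K L] [Algebra K M]
  [Algebra M L] [IsScalarTower K M L] [Finite L]

/-- Nondegeneracy of an `M`-subspace does not depend on the field the trace form maps to. -/
theorem isNondegenerateSubspace_restrictScalars_iff (hq : IsPrimePow q) {m s : ℕ}
    (hL : Nat.card L = q ^ (2 * n)) (hM : Nat.card M = (q ^ m) ^ 2) (hn : n = m * (2 * s + 1))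
    (W : Submodule M L) :
    IsNondegenerateSubspace q n (W.restrictScalars K) ↔
      IsNondegenerateOn (traceForm q n M : L → L → M) W := by
  have hfM := Finite.of_injective _ (FaithfulSMul.algebraMap_injective M L)
  have hfK := Finite.of_injective _ (FaithfulSMul.algebraMap_injective K L)
  have := Fintype.ofFinite M
  have H := isHermitianForm_traceForm (M := M) hq hL hM hn
  have htr : ∀ x y : L, traceForm q n K x y = Algebra.trace K M (traceForm q n M x y) := by
    intro x y
    simp only [traceForm]
    rw [Algebra.trace_trace]
  refine forall₂_congr fun x hx => imp_congr_left ⟨fun h y hy => ?_, fun h y hy => ?_⟩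
  · by_contra hxy
    obtain ⟨b, hb⟩ := Algebra.trace_surjective K M 1
    have h1 := h (((b / traceForm q n M x y) ^ q ^ m) • y) (W.smul_mem _ hy)
    rw [htr, H.smul_right, ← pow_mul, ← sq, ← hM, Nat.card_eq_fintype_card, FiniteField.pow_card,
      div_mul_cancel₀ _ hxy, hb] at h1
    exact one_ne_zero h1
  · rw [htr, h y hy, map_zero]

end Restriction

section FixedSubspaces

variable {q n : ℕ} {K L : Type*} [Field K] [Field L] [Algebra K L] [Finite L]

open IntermediateField

lemma mul_mem_of_mem_adjoin {c : L} {W : Submodule K L} (h : ∀ x ∈ W, c * x ∈ W) {a x : L}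
    (ha : a ∈ K⟮c⟯) (hx : x ∈ W) : a * x ∈ W := by
  have := Finite.of_injective _ (FaithfulSMul.algebraMap_injective K L)
  rw [← mem_toSubalgebra,
    adjoin_simple_toSubalgebra_of_isAlgebraic (Algebra.IsAlgebraic.isAlgebraic c)] at ha
  induction ha using Algebra.adjoin_induction generalizing x with
  | mem y hy => rw [Set.mem_singleton_iff.1 hy]; exact h x hx
  | algebraMap r => rw [← Algebra.smul_def]; exact W.smul_mem r hx
  | add y z _ _ h1 h2 => rw [add_mul]; exact W.add_mem (h1 hx) (h2 hx)
  | mul y z _ _ h1 h2 => rw [mul_assoc]; exact h1 (h2 hx)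

lemma smul_eq_self_iff {C : Subgroup Lˣ} (c : C) (W : Submodule K L) :
    c • W = W ↔ ∃ W' : Submodule K⟮((c : Lˣ) : L)⟯ L, W'.restrictScalars K = W := by
  constructor
  · intro h
    have hc : ∀ x ∈ W, ((c : Lˣ) : L) * x ∈ W := fun x hx =>
      h.le (Submodule.smul_mem_pointwise_smul x c W hx)
    exact ⟨{ W with smul_mem' := fun a x hx => mul_mem_of_mem_adjoin hc a.2 hx }, rfl⟩
  · rintro ⟨W', rfl⟩
    have := Finite.of_injective _ (FaithfulSMul.algebraMap_injective K L)
    refine Submodule.eq_of_le_of_finrank_eq ?_ ?_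
    · intro y hy
      obtain ⟨x, hx, rfl⟩ := (Submodule.mem_smul_pointwise_iff_exists _ _ _).1 hy
      exact W'.smul_mem (AdjoinSimple.gen K ((c : Lˣ) : L)) hx
    · exact (LinearEquiv.finrank_eq (Submodule.equivMapOfInjective
        (DistribSMul.toLinearMap K L c) (MulAction.injective c) _)).symm

/-- The order of `-q` modulo the order of `c` is the degree of `c`. -/
lemma orderOf_dvd_neg_pow_sub_one_iff (hn : Odd n) (hK : Nat.card K = q ^ 2)
    {c : L} (hc0 : c ≠ 0) (hc : c ^ (q ^ n + 1) = 1) {s : ℕ}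
    (hs : n = Module.finrank K K⟮c⟯ * (2 * s + 1)) (i : ℕ) :
    (orderOf c : ℤ) ∣ (-(q : ℤ)) ^ i - 1 ↔ Module.finrank K K⟮c⟯ ∣ i := by
  have := Finite.of_injective _ (FaithfulSMul.algebraMap_injective K L)
  have := Fintype.ofFinite K
  have hpow : ∀ j : ℕ, (orderOf c : ℤ) ∣ ((q : ℤ) ^ 2) ^ j - 1 ↔
      c ^ (Fintype.card K) ^ j = c := by
    intro j
    have hq1 : 1 ≤ (q ^ 2) ^ j := by
      rw [← hK]; exact Nat.one_le_pow _ _ Nat.card_pos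
    have h1 : ((q : ℤ) ^ 2) ^ j - 1 = (((q ^ 2) ^ j - 1 : ℕ) : ℤ) := by
      push_cast [hq1]; rfl
    rw [h1, Int.natCast_dvd_natCast, orderOf_dvd_iff_pow_eq_one, ← Nat.card_eq_fintype_card, hK]
    constructor
    · intro h
      rw [← Nat.sub_add_cancel hq1, pow_succ, h, one_mul]
    · intro h
      apply mul_right_cancel₀ hc0
      rw [← pow_succ, Nat.sub_add_cancel hq1, h, one_mul]
  constructor
  · intro h
    have h1 : c ^ (Fintype.card K) ^ i = c := by
      rw [← hpow, ← neg_sq, ← pow_mul, mul_comm, pow_mul]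
      exact h.trans (by simpa using sub_dvd_pow_sub_pow ((-(q : ℤ)) ^ i) 1 2)
    rw [← FiniteField.orderOf_frobeniusAlgHom K K⟮c⟯, orderOf_dvd_iff_pow_eq_one]
    refine algHom_ext_of_eq_adjoin K rfl fun x hx => ?_
    obtain rfl := Set.mem_singleton_iff.1 hx
    ext
    rw [AlgHom.coe_pow, FiniteField.coe_frobeniusAlgHom, pow_iterate]
    simpa using h1
  · rintro ⟨r, rfl⟩
    have := Fintype.ofFinite K⟮c⟯
    have h1 : c ^ Fintype.card K ^ Module.finrank K K⟮c⟯ = c := by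
      rw [← Module.card_eq_pow_finrank (K := K) (V := K⟮c⟯)]
      exact congrArg Subtype.val (FiniteField.pow_card (AdjoinSimple.gen K c))
    rw [← hpow] at h1
    generalize Module.finrank K K⟮c⟯ = m at hs h1 ⊢
    have hm : Odd m := (Nat.odd_mul.1 (hs ▸ hn)).1
    have h2 : (orderOf c : ℤ) ∣ (q : ℤ) ^ n + 1 := by
      exact_mod_cast orderOf_dvd_of_pow_eq_one hc
    have h3 : (orderOf c : ℤ) ∣ (((q : ℤ) ^ 2) ^ m) ^ s - 1 :=
      h1.trans (by simpa using sub_dvd_pow_sub_pow (((q : ℤ) ^ 2) ^ m) 1 s)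
    have h4 : (orderOf c : ℤ) ∣ (-(q : ℤ)) ^ m - 1 := by
      rw [hm.neg_pow, ← dvd_neg]
      have h5 := dvd_sub h2 (h3.mul_left ((q : ℤ) ^ m))
      have h6 : (q : ℤ) ^ n = (q : ℤ) ^ m * (((q : ℤ) ^ 2) ^ m) ^ s := by
        rw [← pow_mul, ← pow_mul, ← pow_add, hs]
        congr 1
        ring
      obtain ⟨t, ht⟩ := h5
      exact ⟨t, by linear_combination ht - h6⟩
    rw [pow_mul]
    exact h4.trans (by simpa using sub_dvd_pow_sub_pow ((-(q : ℤ)) ^ m) 1 r)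

/-- The subspaces in `nondegenerateSubspaces q n k K L` fixed by `c` are the nondegenerate
`K⟮c⟯`-subspaces of `K`-dimension `k`. -/
lemma ncard_fixed {k s : ℕ} (hq : IsPrimePow q) (hK : Nat.card K = q ^ 2)
    (hL : Nat.card L = q ^ (2 * n)) {C : Subgroup Lˣ} (c : C)
    (hs : n = Module.finrank K K⟮((c : Lˣ) : L)⟯ * (2 * s + 1)) :
    {W : Submodule K L | W ∈ nondegenerateSubspaces q n k K L ∧ c • W = W}.ncard =
      {W : Submodule K⟮((c : Lˣ) : L)⟯ L |
        Module.finrank K K⟮((c : Lˣ) : L)⟯ * Module.finrank K⟮((c : Lˣ) : L)⟯ W = k ∧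
          IsNondegenerateOn (traceForm q n K⟮((c : Lˣ) : L)⟯) W}.ncard := by
  have := Finite.of_injective _ (FaithfulSMul.algebraMap_injective K L)
  have hM : Nat.card K⟮((c : Lˣ) : L)⟯ = (q ^ Module.finrank K K⟮((c : Lˣ) : L)⟯) ^ 2 := by
    rw [Module.natCard_eq_pow_finrank (K := K), hK, ← pow_mul, ← pow_mul, mul_comm]
  rw [← Set.ncard_image_of_injective (_ : Set (Submodule K⟮((c : Lˣ) : L)⟯ L))
    (Submodule.restrictScalars_injective K _ L)]
  refine congrArg Set.ncard (Set.ext fun W => ?_)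
  simp only [Set.mem_ofPred_eq, Set.mem_image]
  constructor
  · rintro ⟨⟨hWk, hW⟩, hcW⟩
    obtain ⟨W', rfl⟩ := (smul_eq_self_iff c W).1 hcW
    refine ⟨W', ⟨?_, (isNondegenerateSubspace_restrictScalars_iff hq hL hM hs W').1 hW⟩, rfl⟩
    rw [← hWk]
    exact Module.finrank_mul_finrank K K⟮((c : Lˣ) : L)⟯ W'
  · rintro ⟨W', ⟨hWk, hW⟩, rfl⟩
    refine ⟨⟨?_, (isNondegenerateSubspace_restrictScalars_iff hq hL hM hs W').2 hW⟩,
      (smul_eq_self_iff c _).2 ⟨W', rfl⟩⟩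
    rw [← hWk]
    exact (Module.finrank_mul_finrank K K⟮((c : Lˣ) : L)⟯ W').symm

end FixedSubspaces

/-- The factorwise comparison of the number of nondegenerate subspaces with the value of the
sieving polynomial. -/
lemma sieving_factor_mul {q m n k s r j : ℕ} (hq : 2 ≤ q) (hm : Odd m) (hn : n = m * (2 * s + 1))
    (hk : k = m * r) (hkn : k ≤ n) (hj : j < r) :
    (q : ℂ) ^ (n - k) * (((q : ℂ) ^ n + (-(q : ℂ)) ^ (m * j)) /
        ((q : ℂ) ^ k - (-1) ^ k * (-(q : ℂ)) ^ (m * j))) *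
      ((-((q : ℂ) ^ m)) ^ (r - j) * ((-((q : ℂ) ^ m)) ^ (r - j) - 1)) =
      (-((q : ℂ) ^ m)) ^ (2 * s + 1 - j) * ((-((q : ℂ) ^ m)) ^ (2 * s + 1 - j) - 1) := by
  have hden : (q : ℂ) ^ k - (-1) ^ k * (-(q : ℂ)) ^ (m * j) ≠ 0 := by
    have h1 : m * j < k := hk ▸ Nat.mul_lt_mul_of_pos_left hj hm.pos
    exact_mod_cast (NegativeQBinomial.denExponent_pos hq h1).ne'
  have hr : r ≤ 2 * s + 1 := by
    rw [hk, hn] at hkn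
    exact Nat.le_of_mul_le_mul_left hkn hm.pos
  obtain ⟨a, rfl⟩ : ∃ a, r = j + a := ⟨r - j, by omega⟩
  obtain ⟨b, hb⟩ : ∃ b, 2 * s + 1 = j + a + b := ⟨2 * s + 1 - (j + a), by omega⟩
  have e1 : j + a - j = a := by omega
  have e2 : 2 * s + 1 - j = a + b := by omega
  have e3 : n - k = m * b := by rw [hn, hk, hb, ← Nat.mul_sub]; congr 1; omega
  have hx : ∀ i, (-(q : ℂ)) ^ (m * i) = (-((q : ℂ) ^ m)) ^ i := fun i => by
    rw [pow_mul, hm.neg_pow]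
  have hy : ∀ i, (q : ℂ) ^ (m * i) = (-1) ^ i * (-((q : ℂ) ^ m)) ^ i := fun i => by
    rw [← mul_pow, pow_mul]; simp
  have hsgn : ((-1) ^ k : ℂ) = (-1) ^ (j + a) := by rw [hk, pow_mul, hm.neg_one_pow]
  have hsgn' : ((-1) ^ b : ℂ) = -(-1) ^ (j + a) := by
    have h1 : ((-1) ^ (j + a) * (-1) ^ b : ℂ) = -1 := by
      rw [← pow_add, Odd.neg_one_pow ⟨s, hb.symm⟩]
    have h2 : ((-1) ^ (j + a) * (-1) ^ (j + a) : ℂ) = 1 := by rw [← mul_pow]; simp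
    linear_combination (-1) ^ (j + a) * h1 - (-1) ^ b * h2
  have hn' : (q : ℂ) ^ n = -(-((q : ℂ) ^ m)) ^ (j + a + b) := by
    rw [hn, hy, hb, Odd.neg_one_pow ⟨s, hb.symm⟩, neg_one_mul]
  rw [e1, e2, e3, hn', hx, hsgn]
  rw [hx, hsgn, hk, hy] at hden
  rw [hk, hy, hy]
  generalize -((q : ℂ) ^ m) = x at *
  rw [mul_div_assoc', div_mul_eq_mul_div, div_eq_iff hden]
  rw [hsgn']
  ring

theorem ncard_subspacesIn_top_eq {q m n k s r : ℕ} (hq : IsPrimePow q) {L M : Type*} [Field L]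
    [Field M] [Algebra M L] [Finite L] (hL : Nat.card L = q ^ (2 * n))
    (hM : Nat.card M = (q ^ m) ^ 2) (hm : Odd m) (hn : n = m * (2 * s + 1))
    (hrank : Module.finrank M L = 2 * s + 1) (hk : k = m * r) (hkn : k ≤ n) :
    ((IsHermitianForm.subspacesIn (traceForm q n M : L → L → M) ⊤ r).ncard : ℂ) =
      ∏ j ∈ range r, ((q : ℂ) ^ (n - k) * (((q : ℂ) ^ n + (-(q : ℂ)) ^ (m * j)) /
        ((q : ℂ) ^ k - (-1) ^ k * (-(q : ℂ)) ^ (m * j)))) := by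
  have hq2 : 2 ≤ q := hq.two_le
  have hqm : 2 ≤ q ^ m := hq2.trans (Nat.le_self_pow hm.pos.ne' q)
  have hcount := (isHermitianForm_traceForm (M := M) hq hL hM hn).ncard_subspacesIn hM hqm r ⊤
    (2 * s + 1) (isNondegenerateOn_traceForm_top hL) (by rw [finrank_top, hrank])
  have hcountC := congrArg (Int.cast : ℤ → ℂ) hcount
  push_cast at hcountC
  have hne : ∏ j ∈ range r, ((-((q : ℂ) ^ m)) ^ (r - j) * ((-((q : ℂ) ^ m)) ^ (r - j) - 1)) ≠ 0 := by
    refine prod_ne_zero_iff.2 fun j hj => ?_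
    have hj := mem_range.1 hj
    have hQ : (2 : ℤ) ≤ |(-((q ^ m : ℕ) : ℤ))| := by
      rw [abs_neg, Nat.abs_cast]; exact_mod_cast hqm
    have h1 := NegativeQBinomial.pow_sub_pow_ne_zero hQ (show 0 < r - j by omega)
    have h2 : (-((q ^ m : ℕ) : ℤ)) ≠ 0 := by intro h; rw [h] at hQ; simp at hQ
    have h3 : (((-((q ^ m : ℕ) : ℤ)) ^ (r - j) *
      ((-((q ^ m : ℕ) : ℤ)) ^ (r - j) - (-((q ^ m : ℕ) : ℤ)) ^ 0) : ℤ) : ℂ) ≠ 0 :=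
      Int.cast_ne_zero.2 (mul_ne_zero (pow_ne_zero _ h2) h1)
    push_cast at h3
    simpa using h3
  apply mul_right_cancel₀ hne
  rw [hcountC, ← prod_mul_distrib]
  exact prod_congr rfl fun j hj =>
    (sieving_factor_mul hq2 hm hn hk hkn (mem_range.1 hj)).symm

end FiniteHermitian

open FiniteHermitian IntermediateField in
theorem theorem5p4 (q n k : ℕ) (hq : IsPrimePow q) (hn : Odd n) (hk : k ≤ n)
    (K L : Type*) [Field K] [Field L] [Algebra K L]
    (hK : Nat.card K = q ^ 2) (hL : Nat.card L = q ^ (2 * n))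
    (γ : Lˣ) (hγ : ∀ x : Lˣ, x ∈ Subgroup.zpowers γ) :
    Nat.card (Subgroup.zpowers (γ ^ (q ^ n - 1))) = q ^ n + 1 ∧
    ∃ P : Polynomial ℕ,
      Polynomial.aeval (RatFunc.X : RatFunc ℚ) P = sievingFunction q n k ∧
      CyclicSieving (Subgroup.zpowers (γ ^ (q ^ n - 1)))
        (nondegenerateSubspaces q n k K L) P := by
  have hq2 : 2 ≤ q := hq.two_le
  have hfL : Finite L := Nat.finite_of_card_ne_zero (by rw [hL]; positivity)
  have hfK := Finite.of_injective _ (FaithfulSMul.algebraMap_injective K L)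
  have hqn : 2 ≤ q ^ n := hq2.trans (Nat.le_self_pow hn.pos.ne' q)
  have hcard : Nat.card (Subgroup.zpowers (γ ^ (q ^ n - 1))) = q ^ n + 1 := by
    have h1 : orderOf γ = (q ^ n - 1) * (q ^ n + 1) := by
      rw [orderOf_eq_card_of_forall_mem_zpowers hγ, Nat.card_units, hL, mul_comm 2, pow_mul,
        mul_comm (q ^ n - 1), ← Nat.sq_sub_sq, one_pow]
    rw [Nat.card_zpowers, orderOf_pow_of_dvd (by omega) ⟨_, h1⟩, h1,
      Nat.mul_div_cancel_left _ (by omega)]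
  refine ⟨hcard, ?_⟩
  have hc1 : ∀ c : Subgroup.zpowers (γ ^ (q ^ n - 1)), ((c : Lˣ) : L) ^ (q ^ n + 1) = 1 := by
    intro c
    rw [← hcard]
    have h1 := congrArg (fun u : Subgroup.zpowers (γ ^ (q ^ n - 1)) => ((u : Lˣ) : L))
      (pow_card_eq_one' (x := c))
    simpa using h1
  obtain ⟨P, hP, hPω⟩ := NegativeQBinomial.exists_sieving_polynomial hq2 hn hk
  refine ⟨P, hP, inferInstance, inferInstance, Set.toFinite _,
    fun c W hW => smul_mem_nondegenerateSubspaces c (hc1 c) hW, fun c ω hω => ?_⟩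
  have hord : orderOf ω = orderOf ((c : Lˣ) : L) := by
    rw [hω, orderOf_units, Subgroup.orderOf_coe]
  have hωpos : 0 < orderOf ω := by rw [hω]; exact orderOf_pos c
  set M := K⟮((c : Lˣ) : L)⟯ with hMdef
  have hrankL : Module.finrank K L = n := by
    have h1 := Module.natCard_eq_pow_finrank (K := K) (V := L)
    rw [hL, hK, pow_mul] at h1
    exact (Nat.pow_right_injective (by nlinarith : 2 ≤ q ^ 2) h1).symm
  have hmul := Module.finrank_mul_finrank K M L
  rw [hrankL] at hmul
  have hodd := Nat.odd_mul.1 (hmul ▸ hn)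
  obtain ⟨s, hs⟩ := hodd.2
  have hsn : n = Module.finrank K M * (2 * s + 1) := by rw [← hs, hmul]
  have hM : Nat.card M = (q ^ Module.finrank K M) ^ 2 := by
    rw [Module.natCard_eq_pow_finrank (K := K), hK, ← pow_mul, ← pow_mul, mul_comm]
  obtain ⟨hzero, hval⟩ := hPω ω (Module.finrank K M) hωpos hodd.1.pos ⟨_, hmul.symm⟩
    (fun i => by
      rw [hord]
      exact orderOf_dvd_neg_pow_sub_one_iff hn hK (Units.ne_zero _) (hc1 c) hsn i)
  rw [ncard_fixed hq hK hL c hsn]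
  by_cases hmk : Module.finrank K M ∣ k
  · obtain ⟨r, hr⟩ := hmk
    rw [hval r hr, ← ncard_subspacesIn_top_eq hq hL hM hodd.1 hsn hs hr hk]
    congr 2
    ext W
    simp only [IsHermitianForm.subspacesIn, Set.mem_ofPred_eq, le_top, true_and]
    rw [hr, Nat.mul_right_inj hodd.1.pos.ne']
    exact Iff.rfl
  · rw [hzero hmk]
    have hempty : {W : Submodule M L | Module.finrank K M * Module.finrank M W = k ∧
        IsNondegenerateOn (traceForm q n M) W} = ∅ :=
      Set.eq_empty_of_forall_notMem fun W hW => hmk ⟨_, hW.1.symm⟩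
    rw [hempty, Set.ncard_empty, Nat.cast_zero]
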